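/- Let $\Gamma$ be a countably infinite amenable discrete group acting by homeomorphisms on the Cantor set $X$, and suppose the action is topologically free, i.e. the set of points of $X$ with trivial stabilizer is dense. (Amenability: for all finite $T\subseteq\Gamma$ and $\delta>0$ there is a nonempty finite $F\subseteq\Gamma$ with $|F\cap\bigcap_{s\in T}s^{-1}F|\ge(1-\delta)|F|$.) Let $[[\Gamma\curvearrowright X]]$ be the topological full group: the group of all homeomorphisms $T:X\to X$ for which there are a partition of $X$ into finitely many clopen sets $A_1,\dots,A_n$ and elements $s_1,\dots,s_n\in\Gamma$ with $Tx=s_ix$ for all $i$ and all $x\in A_i$. Let $\mathfrak A(\Gamma,X)\le[[\Gamma\curvearrowright X]]$ be the subgroup generated by the images $\varphi(\mathfrak A_3)$ of the alternating group $\mathfrak A_3\subseteq\mathfrak S_3$ under all homomorphisms $\varphi:\mathfrak S_3\to[[\Gamma\curvearrowright X]]$ for which there exist pairwise disjoint clopen sets $A_1,A_2,A_3\subseteq X$ such that, for every $\sigma\in\mathfrak S_3$, $\varphi(\sigma)$ is the identity off $A_1\sqcup A_2\sqcup A_3$ and $\varphi(\sigma)A_i=A_{\sigma(i)}$ for $i=1,2,3$.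 Then every subgroup $G$ of $[[\Gamma\curvearrowright X]]$ containing $\mathfrak A(\Gamma,X)$ has property Gamma. That is: $G$ is ICC (the conjugacy class of every $g\in G\setminus\{1\}$ is infinite); the group von Neumann algebra $\mathscr L G=\lambda(G)''\subseteq B(\ell^2(G))$ generated by the left regular representation $\lambda$, with its canonical trace $\tau(a)=\langle a\delta_1,\delta_1\rangle$, is a II$_1$ factor (an infinite-dimensional factor on which $\tau$ is a faithful normal tracial state); and for every $\varepsilon>0$ and every finite set $\Omega\subseteq\mathscr L G$ there is a unitary $u\in\mathscr L G$ with $\tau(u)=0$ and $\|au-ua\|_2<\varepsilon$ for all $a\in\Omega$, where $\|x\|_2=\tau(x^*x)^{1/2}$. -/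

import Mathlib

/-! ### Amenability and topological freeness -/

/-- A finite set `F` in a group is `(T, δ)`-invariant if
`|F ∩ ⋂ s ∈ T, s⁻¹ F| ≥ (1 - δ) |F|`. -/
def IsInvariantUpTo {Γ : Type*} [Group Γ] (T : Finset Γ) (δ : ℝ) (F : Finset Γ) : Prop :=
  (1 - δ) * (F.card : ℝ) ≤ (Set.ncard {t : Γ | t ∈ F ∧ ∀ s ∈ T, s * t ∈ F} : ℝ)

/-- Amenability of a discrete group (Følner's condition): for every finite `T` and `δ > 0` there
is a nonempty finite `(T, δ)`-invariant set. -/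
def IsAmenableGroup (Γ : Type*) [Group Γ] : Prop :=
  ∀ (T : Finset Γ) (δ : ℝ), 0 < δ → ∃ F : Finset Γ, F.Nonempty ∧ IsInvariantUpTo T δ F

/-- An action is topologically free if the points with trivial stabilizer are dense. -/
def IsTopologicallyFree (Γ X : Type*) [Group Γ] [TopologicalSpace X] [MulAction Γ X] : Prop :=
  Dense {x : X | MulAction.stabilizer Γ x = ⊥}

/-! ### The topological full group and the alternating group -/

section FullGroup

variable (Γ : Type*) {X : Type*} [Group Γ] [TopologicalSpace X] [MulAction Γ X]

/-- `T` is piecewise given by group elements: there are a partition of `X` into finitely many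
clopen sets `A i` and elements `s i` with `T x = s i • x` for `x ∈ A i`. -/
def IsPiecewiseAction (T : X ≃ₜ X) : Prop :=
  ∃ (n : ℕ) (A : Fin n → Set X) (s : Fin n → Γ),
    (∀ i, IsClopen (A i)) ∧ Pairwise (Function.onFun Disjoint A) ∧ (⋃ i, A i) = Set.univ ∧
      ∀ i, ∀ x ∈ A i, T x = s i • x

variable {Γ}

theorem IsPiecewiseAction.of_finite {T : X ≃ₜ X} {ι : Type*} [Finite ι] (A : ι → Set X)
    (s : ι → Γ) (h1 : ∀ i, IsClopen (A i)) (h2 : Pairwise (Function.onFun Disjoint A))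
    (h3 : (⋃ i, A i) = Set.univ) (h4 : ∀ i, ∀ x ∈ A i, T x = s i • x) :
    IsPiecewiseAction Γ T := by
  obtain ⟨n, ⟨e⟩⟩ := Finite.exists_equiv_fin ι
  refine ⟨n, A ∘ e.symm, s ∘ e.symm, fun i => h1 _, ?_, ?_, fun i => h4 _⟩
  · intro i j hij
    exact h2 (fun h => hij (e.symm.injective h))
  · rw [← h3]
    exact e.symm.surjective.iUnion_comp A

variable (Γ X)

/-- The topological full group of the action of `Γ` on `X`. -/
def topologicalFullGroup : Subgroup (X ≃ₜ X) where
  carrier := {T | IsPiecewiseAction Γ T}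
  one_mem' := by
    refine IsPiecewiseAction.of_finite (ι := Unit) (fun _ => Set.univ) (fun _ => 1)
      (fun _ => isClopen_univ) (fun i j h => (h rfl).elim) (Set.iUnion_const _) ?_
    intro i x _
    exact (one_smul Γ x).symm
  mul_mem' := by
    rintro S T ⟨n, A, s, hA1, hA2, hA3, hA4⟩ ⟨m, B, t, hB1, hB2, hB3, hB4⟩
    refine IsPiecewiseAction.of_finite (ι := Fin n × Fin m)
      (fun p => T ⁻¹' A p.1 ∩ B p.2) (fun p => s p.1 * t p.2) ?_ ?_ ?_ ?_
    · exact fun p => ((hA1 p.1).preimage T.continuous).inter (hB1 p.2)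
    · rintro ⟨i, j⟩ ⟨i', j'⟩ hne
      refine Set.disjoint_left.2 ?_
      rintro x ⟨hx1, hx2⟩ ⟨hx3, hx4⟩
      have hi : i = i' := by
        by_contra h
        exact Set.disjoint_left.1 (hA2 h) hx1 hx3
      have hj : j = j' := by
        by_contra h
        exact Set.disjoint_left.1 (hB2 h) hx2 hx4
      exact hne (by rw [hi, hj])
    · refine Set.eq_univ_of_forall fun x => ?_
      have h1 : T x ∈ ⋃ i, A i := hA3 ▸ Set.mem_univ _
      have h2 : x ∈ ⋃ i, B i := hB3 ▸ Set.mem_univ _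
      obtain ⟨i, hi⟩ := Set.mem_iUnion.1 h1
      obtain ⟨j, hj⟩ := Set.mem_iUnion.1 h2
      exact Set.mem_iUnion.2 ⟨(i, j), hi, hj⟩
    · rintro ⟨i, j⟩ x ⟨hx1, hx2⟩
      rw [Homeomorph.mul_apply, hA4 i _ hx1, hB4 j _ hx2, mul_smul]
  inv_mem' := by
    rintro T ⟨n, A, s, hA1, hA2, hA3, hA4⟩
    refine IsPiecewiseAction.of_finite (ι := Fin n) (fun i => T.symm ⁻¹' A i)
      (fun i => (s i)⁻¹) ?_ ?_ ?_ ?_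
    · exact fun i => (hA1 i).preimage T.symm.continuous
    · exact fun i j h => (hA2 h).preimage _
    · rw [← Set.preimage_iUnion, hA3, Set.preimage_univ]
    · intro i x hx
      have h := hA4 i _ hx
      rw [Homeomorph.apply_symm_apply] at h
      change T.symm x = _
      rw [eq_inv_smul_iff]
      exact h.symm

/-- The homomorphisms `φ` from the symmetric group on `d` letters to the topological full group for
which there are pairwise disjoint clopen sets `A i` such that each `φ σ` is the identity off their
union and maps `A i` onto `A (σ i)`. -/
def IsSymmetricEmbedding {d : ℕ} (φ : Equiv.Perm (Fin d) →* topologicalFullGroup Γ X) : Prop :=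
  ∃ A : Fin d → Set X,
    (∀ i, IsClopen (A i)) ∧ Pairwise (Function.onFun Disjoint A) ∧
      ∀ σ : Equiv.Perm (Fin d),
        (∀ x, x ∉ ⋃ i, A i → (φ σ : X ≃ₜ X) x = x) ∧
          ∀ i, (φ σ : X ≃ₜ X) '' A i = A (σ i)

/-- The subgroup of the topological full group generated by the images of the alternating group on
`d` letters under the above homomorphisms. -/
def dynamicalAlternatingGroupOfDegree (d : ℕ) : Subgroup (topologicalFullGroup Γ X) :=
  Subgroup.closure {g | ∃ φ : Equiv.Perm (Fin d) →* topologicalFullGroup Γ X,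
    IsSymmetricEmbedding Γ X φ ∧ ∃ σ ∈ alternatingGroup (Fin d), φ σ = g}

/-- The alternating group `𝔄(Γ, X)` of the action. -/
def dynamicalAlternatingGroup : Subgroup (topologicalFullGroup Γ X) :=
  dynamicalAlternatingGroupOfDegree Γ X 3

end FullGroup

/-! ### II₁ factors and property Gamma -/

section VonNeumann

variable {H : Type*} [NormedAddCommGroup H] [InnerProductSpace ℂ H] [CompleteSpace H]

/-- A von Neumann algebra is a factor if its center consists of the scalars. -/
def IsFactor (M : VonNeumannAlgebra H) : Prop :=
  ∀ z ∈ M, z ∈ M.commutant → ∃ c : ℂ, z = c • (1 : H →L[ℂ] H)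

/-- `τ` is a faithful normal tracial state on `M`. Normality is expressed as ultraweak continuity:
`τ` is of the form `a ↦ ∑ n, ⟪ξ n, a (η n)⟫` with `ξ, η` square-summable. -/
structure IsFaithfulNormalTracialState (M : VonNeumannAlgebra H)
    (τ : M.toStarSubalgebra →ₗ[ℂ] ℂ) : Prop where
  map_one : τ 1 = 1
  nonneg : ∀ a, 0 ≤ (τ (star a * a)).re ∧ (τ (star a * a)).im = 0
  faithful : ∀ a, τ (star a * a) = 0 → a = 0
  tracial : ∀ a b, τ (a * b) = τ (b * a)
  normal : ∃ ξ η : ℕ → H, Summable (fun n => ‖ξ n‖ ^ 2) ∧ Summable (fun n => ‖η n‖ ^ 2) ∧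
    ∀ a : M.toStarSubalgebra, HasSum (fun n => inner ℂ (ξ n) ((a : H →L[ℂ] H) (η n))) (τ a)

/-- `M` is a II₁ factor with trace `τ`. -/
structure IsIIOneFactor (M : VonNeumannAlgebra H) (τ : M.toStarSubalgebra →ₗ[ℂ] ℂ) : Prop where
  factor : IsFactor M
  infinite_dimensional : ¬ FiniteDimensional ℂ M.toStarSubalgebra
  trace : IsFaithfulNormalTracialState M τ

/-- The norm `‖a‖₂ = τ(a* a)^{1/2}`. -/
noncomputable def traceNorm (M : VonNeumannAlgebra H) (τ : M.toStarSubalgebra →ₗ[ℂ] ℂ)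
    (a : M.toStarSubalgebra) : ℝ :=
  Real.sqrt (τ (star a * a)).re

/-- `M` is a II₁ factor with trace `τ` and has property Gamma. -/
structure IsIIOneFactorWithGamma (M : VonNeumannAlgebra H)
    (τ : M.toStarSubalgebra →ₗ[ℂ] ℂ) : Prop where
  isIIOneFactor : IsIIOneFactor M τ
  gamma : ∀ ε : ℝ, 0 < ε → ∀ Ω : Finset M.toStarSubalgebra,
    ∃ u ∈ unitary M.toStarSubalgebra, τ u = 0 ∧
      ∀ a ∈ Ω, traceNorm M τ (a * u - u * a) < ε

/-- The von Neumann algebra generated by a set `S` of operators, i.e. the double commutant of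
`S ∪ S*`. -/
noncomputable def vonNeumannGenerated (S : Set (H →L[ℂ] H)) : VonNeumannAlgebra H where
  toStarSubalgebra :=
    StarSubalgebra.centralizer ℂ (StarSubalgebra.centralizer ℂ S : Set (H →L[ℂ] H))
  centralizer_centralizer' := by
    have h := StarSubalgebra.coe_centralizer_centralizer (R := ℂ) S
    change Set.centralizer (Set.centralizer
      (StarSubalgebra.centralizer ℂ (StarSubalgebra.centralizer ℂ S : Set (H →L[ℂ] H)) :
        Set (H →L[ℂ] H))) =
      (StarSubalgebra.centralizer ℂ (StarSubalgebra.centralizer ℂ S : Set (H →L[ℂ] H)) :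
        Set (H →L[ℂ] H))
    rw [h, Set.centralizer_centralizer_centralizer]

end VonNeumann

/-! ### Group von Neumann algebras -/

section GroupVN

variable {G : Type*} [Group G]

/-- The left regular representation on `ℓ²(G)`: `(λ_g f)(h) = f(g⁻¹ h)`. -/
noncomputable def leftRegular (g : G) : lp (fun _ : G => ℂ) 2 →ₗᵢ[ℂ] lp (fun _ : G => ℂ) 2 where
  toFun f := ⟨fun h => f (g⁻¹ * h), memℓp_gen
    ((Equiv.mulLeft g⁻¹).summable_iff.2 ((lp.memℓp f).summable (by norm_num)))⟩
  map_add' _ _ := rfl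
  map_smul' _ _ := rfl
  norm_map' f := by
    rw [lp.norm_eq_tsum_rpow (by norm_num), lp.norm_eq_tsum_rpow (by norm_num)]
    exact congrArg (· ^ _) ((Equiv.mulLeft g⁻¹).tsum_eq
      (fun h => ‖f h‖ ^ (2 : ENNReal).toReal))

variable (G)

/-- The group von Neumann algebra, generated by the left regular representation. -/
noncomputable def groupVonNeumannAlgebra : VonNeumannAlgebra (lp (fun _ : G => ℂ) 2) :=
  vonNeumannGenerated (Set.range fun g : G => (leftRegular g).toContinuousLinearMap)

open Classical in
/-- The canonical trace `τ(a) = ⟪δ_1, a δ_1⟫` on the group von Neumann algebra. -/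
noncomputable def groupTrace : (groupVonNeumannAlgebra G).toStarSubalgebra →ₗ[ℂ] ℂ where
  toFun a := inner ℂ (lp.single 2 (1 : G) (1 : ℂ) : lp (fun _ : G => ℂ) 2)
    ((a : lp (fun _ : G => ℂ) 2 →L[ℂ] lp (fun _ : G => ℂ) 2) (lp.single 2 (1 : G) (1 : ℂ)))
  map_add' a b := by simp
  map_smul' c a := by simp

/-- All nontrivial conjugacy classes are infinite. -/
def IsICC : Prop :=
  ∀ g : G, g ≠ 1 → (conjugatesOf g).Infinite

/-- The group `G` is ICC and its group von Neumann algebra, with its canonical trace, is a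
II₁ factor with property Gamma. -/
def HasPropertyGamma : Prop :=
  IsICC G ∧ IsIIOneFactorWithGamma (groupVonNeumannAlgebra G) (groupTrace G)

end GroupVN

/-! ### Cocycles of elements of the topological full group -/

section Cocycle

variable {Γ X : Type*} [Group Γ] [TopologicalSpace X] [MulAction Γ X]

/-! Property Gamma follows from large commuting families of involutions that any finite set of group
elements almost permutes, combined with a function of many signs that barely depends on any small
fraction of them.

Involutions (`exists_signHom`). Let finitely many `g` in the full group be given, with locally
constant cocycles, and let `F` be a Følner set for all the cocycle values. Fix a point `x` with
trivial stabilizer. By pigeonhole, infinitely many `r` produce the same cocycle values along `F • r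
• x`. Four such `r j` with the sets `F * r j` disjoint, and a small clopen `A` around `x`, give
disjoint translates `t * r j • A`. For `t` in `F`, swap the translates with `j = 0, 1` and those
with `j = 2, 3`. This permutation is even, so it lies in the alternating group, and the family over
`t` is a copy of the group of signs indexed by `F`. Each `g` multiplies `t * r j` on the left by an
element that does not depend on `j`, so it conjugates the involution at `t` to the one at another
point of `F`, for most `t`.

Unitary (`HasPermutedInvolutions.exists_unitary`). Walsh expansion embeds functions on the sign cube
in the group von Neumann algebra, with trace equal to the mean. The majority function has values ±1
and is odd, so it becomes a unitary of trace zero. Conjugation by `g` is controlled only on a large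
set `J` of indices, where it carries the majority over `J` to the majority over `π J`. Both are
close in mean square to the full majority, by anticoncentration of the full sum and Chebyshev for
the sum over the complement (`sum_sq_majority_sub_le`). Hence `u` almost commutes with each `g`. A
density argument (`IsICC.hasPropertyGamma`) passes from group elements to the whole algebra.

ICC, and with it factoriality, comes from 3-cycles of translates: they fix a free point `x` and send
`g x` to almost any other point of its orbit. -/

theorem IsPiecewiseAction.exists_cocycle {T : X ≃ₜ X} (h : IsPiecewiseAction Γ T) :
    ∃ c : X → Γ, IsLocallyConstant c ∧ (Set.range c).Finite ∧ ∀ x, T x = c x • x := by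
  obtain ⟨n, A, s, h1, h2, h3, h4⟩ := h
  have hex : ∀ x, ∃ i, x ∈ A i := fun x => Set.mem_iUnion.1 (h3 ▸ Set.mem_univ x)
  choose i hi using hex
  have hloc : IsLocallyConstant i := by
    refine (IsLocallyConstant.iff_eventually_eq i).2 fun x => ?_
    filter_upwards [(h1 (i x)).isOpen.mem_nhds (hi x)] with y hy
    by_contra hne
    exact Set.disjoint_left.1 (h2 hne) (hi y) hy
  refine ⟨s ∘ i, hloc.comp s, ?_, fun x => h4 _ _ (hi x)⟩
  exact (Set.finite_range s).subset (Set.range_comp_subset_range i s)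

theorem IsPiecewiseAction.of_cocycle {T : X ≃ₜ X} {c : X → Γ} (hc : IsLocallyConstant c)
    (hfin : (Set.range c).Finite) (h : ∀ x, T x = c x • x) : IsPiecewiseAction Γ T := by
  have := hfin.to_subtype
  refine IsPiecewiseAction.of_finite (ι := Set.range c) (fun i => {x | c x = i}) (fun i => i)
    (fun i => hc.isClopen_fiber _) ?_ ?_ ?_
  · intro i j hij
    refine Set.disjoint_left.2 fun x hx hx' => hij (Subtype.ext ?_)
    exact (show c x = i from hx).symm.trans hx'
  · exact Set.eq_univ_of_forall fun x => Set.mem_iUnion.2 ⟨⟨c x, x, rfl⟩, rfl⟩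
  · rintro i x hx
    rw [h x, show c x = i from hx]

theorem IsLocallyConstant.continuous_smul_self [ContinuousConstSMul Γ X] {c : X → Γ}
    (hc : IsLocallyConstant c) : Continuous fun x => c x • x := by
  refine continuous_iff_continuousAt.2 fun x => ?_
  refine (continuous_const_smul (c x)).continuousAt.congr ?_
  filter_upwards [hc.eventually_eq x] with y hy
  rw [hy]

end Cocycle

/-! ### Permuting disjoint translates of a clopen set -/

section Translates

variable {Γ X ι : Type*} [Group Γ] [MulAction Γ X]

/-- `A` is clopen and its translates by the elements `s i` are pairwise disjoint. -/
structure HasDisjointTranslates [TopologicalSpace X] (s : ι → Γ) (A : Set X) : Prop where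
  isClopen : IsClopen A
  eq_of_mem : ∀ i j y, (s i)⁻¹ • y ∈ A → (s j)⁻¹ • y ∈ A → i = j

open Classical in
/-- The index `i` with `y ∈ s i • A`, if there is one. -/
noncomputable def translateIndex (s : ι → Γ) (A : Set X) (y : X) : Option ι :=
  if h : ∃ i, (s i)⁻¹ • y ∈ A then some h.choose else none

/-- The group element by which `σ` moves `y` when it permutes the translates `s i • A`. -/
noncomputable def translateCocycle (s : ι → Γ) (A : Set X) (σ : Equiv.Perm ι) (y : X) : Γ :=
  (translateIndex s A y).elim 1 fun i => s (σ i) * (s i)⁻¹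

theorem translateIndex_of_notMem {s : ι → Γ} {A : Set X} {y : X} (h : ∀ i, (s i)⁻¹ • y ∉ A) :
    translateIndex s A y = none :=
  dif_neg (not_exists.2 h)

theorem translateCocycle_smul_of_notMem {s : ι → Γ} {A : Set X} {y : X}
    (h : ∀ i, (s i)⁻¹ • y ∉ A) (σ : Equiv.Perm ι) : translateCocycle s A σ y • y = y := by
  simp [translateCocycle, translateIndex_of_notMem h]

namespace HasDisjointTranslates

variable [TopologicalSpace X] {s : ι → Γ} {A : Set X}

theorem translateIndex_eq_some (hA : HasDisjointTranslates s A)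
    {y : X} {i : ι} (h : (s i)⁻¹ • y ∈ A) :
    translateIndex s A y = some i := by
  have hex : ∃ i, (s i)⁻¹ • y ∈ A := ⟨i, h⟩
  rw [translateIndex, dif_pos hex]
  exact congrArg some (hA.eq_of_mem _ _ _ hex.choose_spec h)

theorem translateCocycle_smul (hA : HasDisjointTranslates s A)
    {a : X} (ha : a ∈ A) (σ : Equiv.Perm ι) (i : ι) :
    translateCocycle s A σ (s i • a) • (s i • a) = s (σ i) • a := by
  rw [translateCocycle, hA.translateIndex_eq_some (i := i) (by rwa [inv_smul_smul])]
  simp [mul_smul]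

theorem translateCocycle_smul_mul (hA : HasDisjointTranslates s A) (σ τ : Equiv.Perm ι) (y : X) :
    translateCocycle s A σ (translateCocycle s A τ y • y) • (translateCocycle s A τ y • y) =
      translateCocycle s A (σ * τ) y • y := by
  by_cases h : ∃ i, (s i)⁻¹ • y ∈ A
  · obtain ⟨i, hi⟩ := h
    obtain ⟨a, ha, rfl⟩ : ∃ a ∈ A, y = s i • a := ⟨_, hi, (smul_inv_smul _ _).symm⟩
    rw [hA.translateCocycle_smul ha, hA.translateCocycle_smul ha, hA.translateCocycle_smul ha,
      Equiv.Perm.mul_apply]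
  · push Not at h
    rw [translateCocycle_smul_of_notMem h, translateCocycle_smul_of_notMem h,
      translateCocycle_smul_of_notMem h]

theorem translateCocycle_one_smul (hA : HasDisjointTranslates s A)
    (y : X) : translateCocycle s A 1 y • y = y := by
  by_cases h : ∃ i, (s i)⁻¹ • y ∈ A
  · obtain ⟨i, hi⟩ := h
    obtain ⟨a, ha, rfl⟩ : ∃ a ∈ A, y = s i • a := ⟨_, hi, (smul_inv_smul _ _).symm⟩
    rw [hA.translateCocycle_smul ha, Equiv.Perm.one_apply]
  · push Not at h
    rw [translateCocycle_smul_of_notMem h]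

variable [Finite ι] [ContinuousConstSMul Γ X]

/-- The translates are finitely many clopen sets, so they and the complement of their union are open
pieces on which the index is constant. -/
theorem isLocallyConstant_translateCocycle (hA : HasDisjointTranslates s A) (σ : Equiv.Perm ι) :
    IsLocallyConstant (translateCocycle s A σ) := by
  suffices h : IsLocallyConstant (translateIndex s A) from
    h.comp fun o => o.elim 1 fun i => s (σ i) * (s i)⁻¹
  have hcont : ∀ i, Continuous fun y : X => (s i)⁻¹ • y := fun i => continuous_const_smul _
  refine (IsLocallyConstant.iff_eventually_eq _).2 fun y => ?_
  by_cases h : ∃ i, (s i)⁻¹ • y ∈ A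
  · obtain ⟨i, hi⟩ := h
    filter_upwards [(hA.isClopen.isOpen.preimage (hcont i)).mem_nhds hi] with z hz
    rw [hA.translateIndex_eq_some hi, hA.translateIndex_eq_some hz]
  · push Not at h
    have hev : ∀ᶠ z in nhds y, ∀ i, (s i)⁻¹ • z ∉ A := Filter.eventually_all.2 fun i =>
      (hA.isClopen.compl.isOpen.preimage (hcont i)).mem_nhds (h i)
    filter_upwards [hev] with z hz
    rw [translateIndex_of_notMem h, translateIndex_of_notMem hz]

/-- The homeomorphism permuting the translates `s i • A` according to `σ`. -/
noncomputable def permHomeomorph (hA : HasDisjointTranslates s A) (σ : Equiv.Perm ι) : X ≃ₜ X where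
  toFun y := translateCocycle s A σ y • y
  invFun y := translateCocycle s A σ⁻¹ y • y
  left_inv y := by
    beta_reduce
    rw [hA.translateCocycle_smul_mul, inv_mul_cancel, hA.translateCocycle_one_smul]
  right_inv y := by
    beta_reduce
    rw [hA.translateCocycle_smul_mul, mul_inv_cancel, hA.translateCocycle_one_smul]
  continuous_toFun := (hA.isLocallyConstant_translateCocycle σ).continuous_smul_self
  continuous_invFun := (hA.isLocallyConstant_translateCocycle σ⁻¹).continuous_smul_self

theorem permHomeomorph_mem (hA : HasDisjointTranslates s A) (σ : Equiv.Perm ι) :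
    hA.permHomeomorph σ ∈ topologicalFullGroup Γ X := by
  refine IsPiecewiseAction.of_cocycle (hA.isLocallyConstant_translateCocycle σ) ?_ fun x => rfl
  refine (Set.finite_range fun o : Option ι => o.elim 1 fun i => s (σ i) * (s i)⁻¹).subset ?_
  rintro _ ⟨x, rfl⟩
  exact ⟨translateIndex s A x, rfl⟩

/-- The homomorphism from the permutations of the index set to the topological full group given by
permuting the translates `s i • A`. -/
noncomputable def permHom (hA : HasDisjointTranslates s A)
    : Equiv.Perm ι →* topologicalFullGroup Γ X where
  toFun σ := ⟨hA.permHomeomorph σ, hA.permHomeomorph_mem σ⟩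
  map_one' := Subtype.ext (Homeomorph.ext hA.translateCocycle_one_smul)
  map_mul' σ τ := Subtype.ext
    (Homeomorph.ext fun y => (hA.translateCocycle_smul_mul σ τ y).symm)

theorem permHom_apply (hA : HasDisjointTranslates s A)
    {a : X} (ha : a ∈ A) (σ : Equiv.Perm ι) (i : ι) :
    (hA.permHom σ : X ≃ₜ X) (s i • a) = s (σ i) • a :=
  hA.translateCocycle_smul ha σ i

theorem permHom_apply_of_notMem (hA : HasDisjointTranslates s A)
    {y : X} (h : ∀ i, (s i)⁻¹ • y ∉ A) (σ : Equiv.Perm ι) :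
    (hA.permHom σ : X ≃ₜ X) y = y :=
  translateCocycle_smul_of_notMem h σ

theorem permHom_apply_of_fixed (hA : HasDisjointTranslates s A) {y : X} {σ : Equiv.Perm ι}
    (h : ∀ i, (s i)⁻¹ • y ∈ A → σ i = i) : (hA.permHom σ : X ≃ₜ X) y = y := by
  by_cases hy : ∃ i, (s i)⁻¹ • y ∈ A
  · obtain ⟨i, hi⟩ := hy
    have := hA.permHom_apply hi σ i
    rwa [h i hi, smul_inv_smul] at this
  · exact hA.permHom_apply_of_notMem (not_exists.1 hy) σ

theorem permHom_injective (hA : HasDisjointTranslates s A)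
    (hne : A.Nonempty) : Function.Injective hA.permHom := by
  obtain ⟨a, ha⟩ := hne
  intro σ τ h
  ext i
  have h1 := hA.permHom_apply ha σ i
  rw [h, hA.permHom_apply ha] at h1
  exact (hA.eq_of_mem (τ i) (σ i) (s (τ i) • a) (by rwa [inv_smul_smul])
    (by rw [h1]; rwa [inv_smul_smul])).symm

/-- A 3-cycle lives on the letters `a`, `σ a`, `σ (σ a)`. Embedding `Fin 3` on them turns `finRotate
3` into `σ`, and the translates at these letters witness that the composite is one of the defining
homomorphisms. -/
theorem permHom_mem_of_isThreeCycle (hA : HasDisjointTranslates s A)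
    [Fintype ι] [DecidableEq ι] {σ : Equiv.Perm ι}
    (hσ : σ.IsThreeCycle) : hA.permHom σ ∈ dynamicalAlternatingGroup Γ X := by
  obtain ⟨a, ha⟩ : σ.support.Nonempty := by
    rw [← Finset.card_pos, hσ.card_support]
    norm_num
  have hnd := hσ.nodup_iff_mem_support.2 ha
  have hmul := hσ.eq_swap_mul_swap_iff_mem_support.2 ha
  simp only [List.nodup_cons, List.mem_cons, List.not_mem_nil, or_false, not_or] at hnd
  have hinj : Function.Injective ![a, σ a, σ (σ a)] := by
    intro i j
    fin_cases i <;> fin_cases j <;> simp <;> grind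
  let e : Fin 3 ↪ ι := ⟨_, hinj⟩
  have he : ∀ (τ : Equiv.Perm (Fin 3)) i, Equiv.Perm.viaEmbeddingHom e τ (e i) = e (τ i) :=
    fun τ i => Equiv.Perm.viaEmbedding_apply τ e i
  refine Subgroup.subset_closure ⟨hA.permHom.comp (Equiv.Perm.viaEmbeddingHom e),
    ⟨fun i => (fun y => (s (e i))⁻¹ • y) ⁻¹' A, ?_, ?_, ?_⟩, finRotate 3, ?_, ?_⟩
  · exact fun i => hA.isClopen.preimage (continuous_const_smul _)
  · intro i j hij
    exact Set.disjoint_left.2 fun y hy hy' => hij (e.injective (hA.eq_of_mem _ _ y hy hy'))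
  · intro τ
    refine ⟨fun x hx => ?_, fun i => ?_⟩
    · refine hA.permHom_apply_of_fixed fun j hj => ?_
      refine Equiv.Perm.viaEmbedding_apply_of_notMem τ e j ?_
      rintro ⟨i, rfl⟩
      exact hx (Set.mem_iUnion.2 ⟨i, hj⟩)
    · ext y
      constructor
      · rintro ⟨x, hx, rfl⟩
        have := hA.permHom_apply hx (Equiv.Perm.viaEmbeddingHom e τ) (e i)
        rw [smul_inv_smul, he] at this
        change (s (e (τ i)))⁻¹ • _ ∈ A
        rw [MonoidHom.comp_apply, this, inv_smul_smul]
        exact hx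
      · intro hy
        refine ⟨s (e i) • (s (e (τ i)))⁻¹ • y, ?_, ?_⟩
        · change (s (e i))⁻¹ • s (e i) • _ ∈ A
          rw [inv_smul_smul]
          exact hy
        · rw [MonoidHom.comp_apply, hA.permHom_apply hy, he, smul_inv_smul]
  · exact Equiv.Perm.mem_alternatingGroup.2 (by rw [sign_finRotate]; decide)
  · rw [MonoidHom.comp_apply]
    congr 1
    ext i
    by_cases hi : i ∈ Set.range e
    · obtain ⟨j, rfl⟩ := hi
      rw [he]
      fin_cases j
      · rfl
      · rfl
      · change a = σ (σ (σ a))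
        have h3 : σ ^ 3 = 1 := hσ.orderOf ▸ pow_orderOf_eq_one σ
        exact (congrArg (fun τ : Equiv.Perm ι => τ a) h3).symm
    · rw [show Equiv.Perm.viaEmbeddingHom e (finRotate 3) i = i from
        Equiv.Perm.viaEmbedding_apply_of_notMem _ e i hi]
      have h1 : i ≠ a := fun h => hi ⟨0, h.symm⟩
      have h2 : i ≠ σ a := fun h => hi ⟨1, h.symm⟩
      have h3 : i ≠ σ (σ a) := fun h => hi ⟨2, h.symm⟩
      rw [hmul, Equiv.Perm.mul_apply, Equiv.swap_apply_of_ne_of_ne h2 h3,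
        Equiv.swap_apply_of_ne_of_ne h1 h2]

theorem permHom_mem_of_mem_alternatingGroup (hA : HasDisjointTranslates s A)
    [Fintype ι] [DecidableEq ι] {σ : Equiv.Perm ι}
    (hσ : σ ∈ alternatingGroup ι) : hA.permHom σ ∈ dynamicalAlternatingGroup Γ X := by
  rw [← Equiv.Perm.closure_three_cycles_eq_alternating] at hσ
  have : Subgroup.closure {τ : Equiv.Perm ι | τ.IsThreeCycle} ≤
      (dynamicalAlternatingGroup Γ X).comap hA.permHom :=
    (Subgroup.closure_le _).2 fun τ hτ => hA.permHom_mem_of_isThreeCycle hτ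
  exact this hσ

end HasDisjointTranslates

theorem smul_injective_of_stabilizer_eq_bot {x : X} (hx : MulAction.stabilizer Γ x = ⊥) :
    Function.Injective fun g : Γ => g • x := by
  intro g h hgh
  have : h⁻¹ * g ∈ MulAction.stabilizer Γ x := by
    rw [MulAction.mem_stabilizer_iff, mul_smul, show g • x = h • x from hgh, inv_smul_smul]
  rw [hx, Subgroup.mem_bot] at this
  exact (inv_mul_eq_one.1 this).symm

/-- A point with trivial stabilizer has arbitrarily small clopen neighbourhoods with disjoint
translates by a given finite injective family of group elements. -/
theorem exists_hasDisjointTranslates [Finite ι] [TopologicalSpace X]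
    [ContinuousConstSMul Γ X] [T2Space X] [CompactSpace X] [TotallyDisconnectedSpace X] {x : X}
    (hx : MulAction.stabilizer Γ x = ⊥) {s : ι → Γ} (hs : Function.Injective s) {U : Set X}
    (hU : U ∈ nhds x) : ∃ A, HasDisjointTranslates s A ∧ x ∈ A ∧ A ⊆ U := by
  -- Disjointness of two translates of `A` concerns two independent points of `A`, hence the
  -- neighbourhood of the diagonal point in `X × X`.
  have hev : ∀ᶠ p : X × X in nhds x ×ˢ nhds x, ∀ i j, i ≠ j → s i • p.1 ≠ s j • p.2 := by
    rw [← nhds_prod_eq]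
    refine Filter.eventually_all.2 fun i => Filter.eventually_all.2 fun j => ?_
    by_cases hij : i = j
    · exact Filter.Eventually.of_forall fun p h => (h hij).elim
    have hopen : IsOpen {p : X × X | s i • p.1 ≠ s j • p.2} :=
      isOpen_ne_fun (continuous_fst.const_smul _) (continuous_snd.const_smul _)
    filter_upwards [hopen.mem_nhds (show (x, x) ∈ _ from
      fun h => hij (hs (smul_injective_of_stabilizer_eq_bot hx h)))] with p hp _ using hp
  obtain ⟨V, hV, hV'⟩ := Filter.eventually_prod_self_iff'.1 hev
  obtain ⟨A, hA, hxA, hAV⟩ := compact_exists_isClopen_in_isOpen isOpen_interior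
    (mem_interior_iff_mem_nhds.2 (Filter.inter_mem hU hV))
  have hAV' := hAV.trans interior_subset
  refine ⟨A, ⟨hA, fun i j y hi hj => ?_⟩, hxA, fun y hy => (hAV' hy).1⟩
  by_contra hij
  refine hV' _ (hAV' hi).2 _ (hAV' hj).2 i j hij ?_
  simp

end Translates

/-! ### Commuting involutions permuted by prescribed elements of the full group -/

section SignHom

/-- The homomorphism from the group of order two sending `-1` to a double transposition. -/
def doubleTranspositionHom : ℤˣ →* Equiv.Perm (Fin 4) where
  toFun a := if a = -1 then Equiv.swap 0 1 * Equiv.swap 2 3 else 1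
  map_one' := by decide
  map_mul' := by decide

theorem doubleTranspositionHom_injective : Function.Injective doubleTranspositionHom := by
  unfold Function.Injective
  decide

/-- Evenness is the reason for using four translates per sign: a single swap of two translates would
be odd. -/
theorem sign_doubleTranspositionHom (a : ℤˣ) :
    Equiv.Perm.sign (doubleTranspositionHom a) = 1 := by
  revert a
  decide

/-- The product over `I` of copies of `doubleTranspositionHom`. -/
def fiberwiseHom (I : Type*) : (I → ℤˣ) →* Equiv.Perm (I × Fin 4) where
  toFun v := Equiv.prodCongrRight fun i => doubleTranspositionHom (v i)
  map_one' := by ext ⟨i, j⟩ <;> simp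
  map_mul' v w := by ext ⟨i, j⟩ <;> simp

theorem fiberwiseHom_apply {I : Type*} (v : I → ℤˣ) (i : I) (j : Fin 4) :
    fiberwiseHom I v (i, j) = (i, doubleTranspositionHom (v i) j) :=
  rfl

theorem fiberwiseHom_injective (I : Type*) : Function.Injective (fiberwiseHom I) := by
  intro v w h
  funext i
  refine doubleTranspositionHom_injective (Equiv.ext fun j => ?_)
  have := DFunLike.congr_fun h (i, j)
  rw [fiberwiseHom_apply, fiberwiseHom_apply] at this
  exact (Prod.ext_iff.1 this).2

theorem fiberwiseHom_mem_alternatingGroup {I : Type*} [Fintype I] [DecidableEq I] (v : I → ℤˣ) :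
    fiberwiseHom I v ∈ alternatingGroup (I × Fin 4) := by
  rw [Equiv.Perm.mem_alternatingGroup]
  exact (Equiv.Perm.sign_prodCongrRight _).trans
    (Finset.prod_eq_one fun i _ => sign_doubleTranspositionHom _)

end SignHom

section Dynamics

variable {Γ X : Type*} [Group Γ] [MulAction Γ X]

/-- An infinite set of group elements contains four elements `r j` for which the sets `F * r j` are
pairwise disjoint. -/
theorem exists_mul_injective_of_infinite {R : Set Γ} (hR : R.Infinite) (F : Finset Γ) :
    ∃ r : Fin 4 → Γ, (∀ j, r j ∈ R) ∧
      Function.Injective fun p : F × Fin 4 => (p.1 : Γ) * r p.2 := by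
  classical
  obtain ⟨f, hf, hf'⟩ := exists_seq_of_forall_finset_exists (α := Γ) (fun r => r ∈ R)
    -- Greedy choice: each new element only has to avoid the finitely many `d⁻¹ * (c * a)` with `a`
    -- chosen earlier.
    (fun a b => ∀ c ∈ F, ∀ d ∈ F, c * a ≠ d * b) (fun s _ => by
      let B : Finset Γ := (F ×ˢ F ×ˢ s).image fun p => p.2.1⁻¹ * (p.1 * p.2.2)
      obtain ⟨y, hy, hyB⟩ := hR.exists_notMem_finset B
      refine ⟨y, hy, fun a ha c hc d hd h => hyB ?_⟩
      refine Finset.mem_image.2 ⟨(c, d, a), by simp [ha, hc, hd], ?_⟩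
      rw [h, inv_mul_cancel_left])
  refine ⟨fun j => f j, fun j => hf _, ?_⟩
  rintro ⟨a, i⟩ ⟨b, j⟩ h
  have h' : (a : Γ) * f i = b * f j := h
  rcases lt_trichotomy i j with hij | rfl | hij
  · exact (hf' _ _ hij _ a.2 _ b.2 h').elim
  · simpa using h
  · exact (hf' _ _ hij _ b.2 _ a.2 h'.symm).elim

theorem IsAmenableGroup.exists_invariant_card_ge [Infinite Γ] (hΓ : IsAmenableGroup Γ)
    (T : Finset Γ) {δ : ℝ} (hδ : 0 < δ) (N : ℕ) :
    ∃ F C : Finset Γ, C ⊆ F ∧ N ≤ F.card ∧ (1 - δ) * F.card ≤ C.card ∧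
      ∀ t ∈ C, ∀ s ∈ T, s * t ∈ F := by
  classical
  obtain ⟨E, hE⟩ := Infinite.exists_subset_card_eq Γ N
  -- Invariance under `E` as well forces `F` to contain a translate `E * t`, hence at least `N`
  -- elements. The bound `1 / 2` guarantees that such a `t` exists.
  obtain ⟨F, hF, hinv⟩ := hΓ (T ∪ E) (min δ (1 / 2)) (by positivity)
  let C := F.filter fun t => ∀ s ∈ T ∪ E, s * t ∈ F
  have hC : {t : Γ | t ∈ F ∧ ∀ s ∈ T ∪ E, s * t ∈ F} = C := by
    ext t
    simp [C]
  rw [IsInvariantUpTo, hC, Set.ncard_coe_finset] at hinv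
  have hFpos : (0 : ℝ) < F.card := by exact_mod_cast hF.card_pos
  have hCpos : 0 < C.card := by
    have : (0 : ℝ) < C.card := by nlinarith [min_le_right δ (1 / 2 : ℝ)]
    exact_mod_cast this
  obtain ⟨t, ht⟩ := Finset.card_pos.1 hCpos
  refine ⟨F, C, Finset.filter_subset _ _, ?_, ?_, ?_⟩
  · rw [← hE, ← Finset.card_image_of_injective E (mul_left_injective t)]
    refine Finset.card_le_card fun y hy => ?_
    obtain ⟨s, hs, rfl⟩ := Finset.mem_image.1 hy
    exact (Finset.mem_filter.1 ht).2 s (Finset.mem_union_right _ hs)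
  · nlinarith [min_le_left δ (1 / 2 : ℝ)]
  · exact fun t ht s hs => (Finset.mem_filter.1 ht).2 s (Finset.mem_union_left _ hs)

/-- For finitely many elements `g` of the full group there are arbitrarily large finite families of
independent commuting involutions in the alternating group, most of whose members are permuted among
themselves under conjugation by each `g`. -/
theorem exists_signHom [Infinite Γ] (hΓ : IsAmenableGroup Γ) [TopologicalSpace X]
    [ContinuousConstSMul Γ X] [T2Space X] [CompactSpace X] [TotallyDisconnectedSpace X]
    [Nonempty X] (hfree : IsTopologicallyFree Γ X) (S : Finset (topologicalFullGroup Γ X))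
    {δ : ℝ} (hδ : 0 < δ) (N : ℕ) :
    ∃ (I : Finset Γ) (h : (I → ℤˣ) →* topologicalFullGroup Γ X), N ≤ I.card ∧
      Function.Injective h ∧ (∀ v, h v ∈ dynamicalAlternatingGroup Γ X) ∧
      ∀ g ∈ S, ∃ (J : Finset I) (π : Equiv.Perm I), (1 - δ) * I.card ≤ J.card ∧
        ∀ v : I → ℤˣ, (∀ i ∉ J, v i = 1) → g * h v * g⁻¹ = h (v ∘ π.symm) := by
  classical
  choose c hcloc hcfin hc using
    fun g : topologicalFullGroup Γ X => IsPiecewiseAction.exists_cocycle g.2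
  obtain ⟨F, C, hCF, hN, hC, hCT⟩ :=
    hΓ.exists_invariant_card_ge (S.biUnion fun g => (hcfin g).toFinset) hδ N
  obtain ⟨x, hx⟩ := hfree.nonempty
  have hxinj := smul_injective_of_stabilizer_eq_bot hx
  -- the pattern of cocycle values along `F` at a point takes finitely many values
  let pat : Γ → (S × F → Γ) := fun r p => c p.1 ((p.2 : Γ) • r • x)
  have hpat : (Set.range pat).Finite := by
    refine (Set.Finite.pi' fun p : S × F => hcfin p.1).subset ?_
    rintro _ ⟨r, rfl⟩ p
    exact ⟨_, rfl⟩
  -- Pigeonhole: infinitely many `r` share one pattern `P`.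
  obtain ⟨P, hP⟩ : ∃ P, (pat ⁻¹' {P}).Infinite := by
    by_contra! hcon
    have hu : (⋃ P ∈ Set.range pat, pat ⁻¹' {P}).Finite :=
      hpat.biUnion fun P _ => Set.not_infinite.1 (fun hi => hi (hcon P))
    refine Set.infinite_univ (hu.subset fun r _ => ?_)
    simp
  obtain ⟨r, hrP, hrinj⟩ := exists_mul_injective_of_infinite hP F
  let s : F × Fin 4 → Γ := fun p => (p.1 : Γ) * r p.2
  have hU : ∀ᶠ a in nhds x, ∀ p : S × F, ∀ j, c p.1 (((p.2 : Γ) * r j) • a) = P p := by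
    refine Filter.eventually_all.2 fun p => Filter.eventually_all.2 fun j => ?_
    have hcont : Continuous fun a : X => ((p.2 : Γ) * r j) • a := continuous_const_smul _
    filter_upwards [hcont.continuousAt.eventually ((hcloc p.1).eventually_eq _)] with a ha
    rw [ha, ← congrFun (hrP j) p, mul_smul]
  obtain ⟨A, hA, hxA, hAU⟩ := exists_hasDisjointTranslates hx hrinj hU
  refine ⟨F, hA.permHom.comp (fiberwiseHom F), hN,
    (hA.permHom_injective ⟨x, hxA⟩).comp (fiberwiseHom_injective F),
    fun v => hA.permHom_mem_of_mem_alternatingGroup (fiberwiseHom_mem_alternatingGroup v),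
    fun g hg => ?_⟩
  let J : Finset F := Finset.univ.filter fun i => (i : Γ) ∈ C
  have hJ : J.card = C.card := by
    rw [← Finset.card_map (Function.Embedding.subtype _)]
    congr 1
    ext t
    simp only [J, Finset.mem_map, Finset.mem_filter, Finset.mem_univ, true_and,
      Function.Embedding.coe_subtype]
    exact ⟨fun ⟨i, hi, h⟩ => h ▸ hi, fun ht => ⟨⟨t, hCF ht⟩, ht, rfl⟩⟩
  -- The multiplier `P (g, i)` is the same for all four `j`, so `g` moves the four translates over
  -- `i` in parallel.
  have hmove : ∀ (i : F) (j : Fin 4), ∀ a ∈ A,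
      (g : X ≃ₜ X) (s (i, j) • a) = (P (⟨g, hg⟩, i) * i * r j) • a := by
    intro i j a ha
    rw [hc g, hAU ha (⟨g, hg⟩, i) j]
    simp only [s, mul_smul]
  -- Left multiplication by the cocycle value maps `J` into `F` by Følner invariance, and
  -- injectively because `g` is injective on the orbit of `x`. Any extension to a permutation of `F`
  -- will do.
  obtain ⟨π, hπ⟩ : ∃ π : F ≃ F, ∀ i ∈ J, (π i : Γ) = P (⟨g, hg⟩, i) * i := by
    refine Finset.exists_equiv_extend_of_card_eq (by simp)
      (f := fun i => P (⟨g, hg⟩, i) * i) ?_ ?_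
    · intro t ht
      obtain ⟨i, hi, rfl⟩ := Finset.mem_image.1 ht
      refine hCT _ (Finset.mem_filter.1 hi).2 _ (Finset.mem_biUnion.2 ⟨g, hg, ?_⟩)
      rw [Set.Finite.mem_toFinset]
      exact ⟨_, congrFun (hrP 0) (⟨g, hg⟩, i)⟩
    · intro i _ i' _ h
      have h1 : (g : X ≃ₜ X) (s (i, 0) • x) = (g : X ≃ₜ X) (s (i', 0) • x) := by
        rw [hmove i 0 x hxA, hmove i' 0 x hxA]
        exact congrArg (fun t => (t * r 0) • x) h
      exact (Prod.ext_iff.1 (hrinj (hxinj ((g : X ≃ₜ X).injective h1)))).1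
  refine ⟨J, π, by rwa [hJ], fun v hv => ?_⟩
  have hmove' : ∀ i ∈ J, ∀ j, ∀ a ∈ A, (g : X ≃ₜ X) (s (i, j) • a) = s (π i, j) • a := by
    intro i hi j a ha
    rw [hmove i j a ha]
    simp only [s, hπ i hi]
  rw [mul_inv_eq_iff_eq_mul]
  refine Subtype.ext (Homeomorph.ext fun y => ?_)
  change (g : X ≃ₜ X) ((hA.permHom (fiberwiseHom F v) : X ≃ₜ X) y) =
    (hA.permHom (fiberwiseHom F (v ∘ π.symm)) : X ≃ₜ X) ((g : X ≃ₜ X) y)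
  -- Off the translates over `J` both sides reduce to `g y`: `v` is trivial outside `J`, and `g y`
  -- avoids the translates over `π J`.
  by_cases hy : ∃ i ∈ J, ∃ j, (s (i, j))⁻¹ • y ∈ A
  · obtain ⟨i, hi, j, hj⟩ := hy
    obtain ⟨a, ha, rfl⟩ : ∃ a ∈ A, y = s (i, j) • a := ⟨_, hj, (smul_inv_smul _ _).symm⟩
    rw [hA.permHom_apply ha, fiberwiseHom_apply, hmove' i hi _ a ha, hmove' i hi _ a ha,
      hA.permHom_apply ha, fiberwiseHom_apply]
    simp [s]
  · rw [hA.permHom_apply_of_fixed, hA.permHom_apply_of_fixed]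
    · rintro ⟨i, j⟩ hij
      by_cases hi : π.symm i ∈ J
      · refine (hy ⟨_, hi, j, ?_⟩).elim
        have h1 := hmove' _ hi j _ hij
        rw [Equiv.apply_symm_apply, smul_inv_smul] at h1
        rw [← (g : X ≃ₜ X).injective h1, inv_smul_smul]
        exact hij
      · rw [fiberwiseHom_apply, Function.comp_apply, hv _ hi, map_one, Equiv.Perm.one_apply]
    · rintro ⟨i, j⟩ hij
      have hi : i ∉ J := fun hi => hy ⟨i, hi, j, hij⟩
      rw [fiberwiseHom_apply, hv _ hi, map_one, Equiv.Perm.one_apply]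

/-! ### Infinite conjugacy classes -/

/-- If `g x = s • x ≠ x` at a free point and `h` fixes `x` and sends `s • x` to `p • x`, then `h * g
* h⁻¹` sends `x` to `p • x`. Infinitely many `p` are possible, and distinct `p` give distinct
conjugates. -/
theorem isICC_of_dynamicalAlternatingGroup_le [Infinite Γ] [TopologicalSpace X]
    [ContinuousConstSMul Γ X] [T2Space X] [CompactSpace X] [TotallyDisconnectedSpace X]
    (hfree : IsTopologicallyFree Γ X) (G : Subgroup (topologicalFullGroup Γ X))
    (hG : dynamicalAlternatingGroup Γ X ≤ G) : IsICC G := by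
  classical
  intro g hg
  obtain ⟨y, hy⟩ : ∃ y, ((g : topologicalFullGroup Γ X) : X ≃ₜ X) y ≠ y := by
    by_contra! h
    exact hg (Subtype.ext (Subtype.ext (Homeomorph.ext h)))
  obtain ⟨x, hxg, hx⟩ := hfree.inter_open_nonempty
    {y | ((g : topologicalFullGroup Γ X) : X ≃ₜ X) y ≠ y}
    (isOpen_ne_fun (Homeomorph.continuous _) continuous_id) ⟨y, hy⟩
  have hxinj := smul_injective_of_stabilizer_eq_bot hx
  obtain ⟨c, -, -, hc⟩ := IsPiecewiseAction.exists_cocycle (g : topologicalFullGroup Γ X).2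
  set s := c x with hs
  have hs1 : s ≠ 1 := by
    intro h
    apply hxg
    rw [hc, ← hs, h, one_smul]
  have key : ∀ p : Γ, p ≠ 1 → p ≠ s → ∃ k ∈ conjugatesOf g,
      ((k : topologicalFullGroup Γ X) : X ≃ₜ X) x = p • x := by
    intro p hp1 hps
    -- A third letter `q` is needed so that `s ↦ p` can be completed to a 3-cycle, which is even.
    obtain ⟨q, hq⟩ := Infinite.exists_notMem_finset ({1, s, p} : Finset Γ)
    simp only [Finset.mem_insert, Finset.mem_singleton, not_or] at hq
    obtain ⟨hq1, hqs, hqp⟩ := hq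
    have hinj : Function.Injective ![1, s, p, q] := by
      intro i j
      fin_cases i <;> fin_cases j <;> simp <;> grind
    obtain ⟨A, hA, hxA, -⟩ := exists_hasDisjointTranslates hx hinj Filter.univ_mem
    let σ : Equiv.Perm (Fin 4) := Equiv.swap 1 2 * Equiv.swap 2 3
    let h : G := ⟨hA.permHom σ, hG (hA.permHom_mem_of_mem_alternatingGroup
      (Equiv.Perm.mem_alternatingGroup.2 (by decide)))⟩
    have hx0 : ((h : topologicalFullGroup Γ X) : X ≃ₜ X) x = x := by
      have := hA.permHom_apply hxA σ 0
      rw [show σ 0 = 0 by decide] at this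
      simpa using this
    have hx1 : ((h : topologicalFullGroup Γ X) : X ≃ₜ X) (s • x) = p • x := by
      have := hA.permHom_apply hxA σ 1
      rw [show σ 1 = 2 by decide] at this
      simpa using this
    refine ⟨h * g * h⁻¹, isConj_iff.2 ⟨h, rfl⟩, ?_⟩
    have hx0' : (((h⁻¹ : G) : topologicalFullGroup Γ X) : X ≃ₜ X) x = x := by
      conv_lhs => rw [← hx0]
      exact Homeomorph.symm_apply_apply _ _
    change ((h : topologicalFullGroup Γ X) : X ≃ₜ X)
      (((g : topologicalFullGroup Γ X) : X ≃ₜ X)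
        ((((h⁻¹ : G) : topologicalFullGroup Γ X) : X ≃ₜ X) x)) = p • x
    rw [hx0', hc, ← hs, hx1]
  intro hfin
  have hinf : ((fun p : Γ => p • x) '' ({1, s} : Set Γ)ᶜ).Infinite :=
    Set.Infinite.image hxinj.injOn (Set.toFinite _).infinite_compl
  refine hinf ((hfin.image fun k : G =>
    ((k : topologicalFullGroup Γ X) : X ≃ₜ X) x).subset ?_)
  rintro _ ⟨p, hp, rfl⟩
  simp only [Set.mem_compl_iff, Set.mem_insert_iff, Set.mem_singleton_iff, not_or] at hp
  obtain ⟨k, hk, hkx⟩ := key p hp.1 hp.2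
  exact ⟨k, hk, hkx⟩

end Dynamics

/-! ### Walsh expansions on the group of signs -/

section Walsh

/-- The pairing of the group of order two with itself. -/
def signPairing (a b : ℤˣ) : ℝ := if a = -1 then ((b : ℤ) : ℝ) else 1

theorem signPairing_comm (a b : ℤˣ) : signPairing a b = signPairing b a := by
  rcases Int.units_eq_one_or a with rfl | rfl <;> rcases Int.units_eq_one_or b with rfl | rfl <;>
    simp [signPairing]

theorem signPairing_mul_left (a b c : ℤˣ) :
    signPairing (a * b) c = signPairing a c * signPairing b c := by
  rcases Int.units_eq_one_or a with rfl | rfl <;> rcases Int.units_eq_one_or b with rfl | rfl <;>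
    rcases Int.units_eq_one_or c with rfl | rfl <;> simp [signPairing]

theorem sum_signPairing (b : ℤˣ) : ∑ a, signPairing a b = if b = 1 then 2 else 0 := by
  rw [show (Finset.univ : Finset ℤˣ) = {1, -1} from rfl, Finset.sum_pair (by decide)]
  rcases Int.units_eq_one_or b with rfl | rfl <;> norm_num [signPairing]

theorem sign_mul_eq_one_iff {I : Type*} (ε ε' : I → ℤˣ) : ε * ε' = 1 ↔ ε' = ε := by
  rw [mul_eq_one_iff_inv_eq, eq_comm, show ε⁻¹ = ε from funext fun i => Int.units_inv_eq_self _]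

variable {I : Type*} [Fintype I]

/-- The Walsh functions on `I → ℤˣ`. -/
def walsh (v ε : I → ℤˣ) : ℝ := ∏ i, signPairing (v i) (ε i)

theorem walsh_comm (v ε : I → ℤˣ) : walsh v ε = walsh ε v :=
  Finset.prod_congr rfl fun _ _ => signPairing_comm _ _

theorem walsh_mul_left (v w ε : I → ℤˣ) : walsh (v * w) ε = walsh v ε * walsh w ε := by
  rw [walsh, walsh, walsh, ← Finset.prod_mul_distrib]
  exact Finset.prod_congr rfl fun _ _ => signPairing_mul_left _ _ _

theorem walsh_mul_right (v ε ε' : I → ℤˣ) : walsh v (ε * ε') = walsh v ε * walsh v ε' := by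
  rw [walsh_comm, walsh_mul_left, walsh_comm ε, walsh_comm ε']

theorem walsh_one_left (ε : I → ℤˣ) : walsh 1 ε = 1 :=
  Finset.prod_eq_one fun i _ => by
    rw [Pi.one_apply, signPairing, if_neg (by decide)]

theorem walsh_comp_perm (π : Equiv.Perm I) (v ε : I → ℤˣ) : walsh (v ∘ π) (ε ∘ π) = walsh v ε :=
  Equiv.prod_comp π fun i => signPairing (v i) (ε i)

variable [DecidableEq I]

theorem sum_walsh (ε : I → ℤˣ) :
    ∑ v, walsh v ε = if ε = 1 then (2 : ℝ) ^ Fintype.card I else 0 := by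
  have h : ∑ v, walsh v ε = ∏ i, ∑ a, signPairing a (ε i) := by
    rw [Finset.prod_univ_sum, Fintype.piFinset_univ]
    rfl
  rw [h]
  simp only [sum_signPairing]
  split_ifs with h1
  · simp [h1]
  · obtain ⟨i, hi⟩ := Function.ne_iff.1 h1
    exact Finset.prod_eq_zero (Finset.mem_univ i) (if_neg hi)

/-- The Walsh coefficients of a function on `I → ℤˣ`. -/
noncomputable def walshCoeff (f : (I → ℤˣ) → ℝ) (v : I → ℤˣ) : ℝ :=
  ((2 : ℝ) ^ Fintype.card I)⁻¹ * ∑ ε, f ε * walsh v ε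

theorem walshCoeff_sub (f g : (I → ℤˣ) → ℝ) (v : I → ℤˣ) :
    walshCoeff (f - g) v = walshCoeff f v - walshCoeff g v := by
  simp only [walshCoeff, Pi.sub_apply, sub_mul, Finset.sum_sub_distrib, mul_sub]

theorem walshCoeff_apply_one (f : (I → ℤˣ) → ℝ) :
    walshCoeff f 1 = ((2 : ℝ) ^ Fintype.card I)⁻¹ * ∑ ε, f ε := by
  simp only [walshCoeff, walsh_one_left, mul_one]

theorem walshCoeff_one (v : I → ℤˣ) : walshCoeff 1 v = if v = 1 then 1 else 0 := by
  rw [walshCoeff]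
  simp only [Pi.one_apply, one_mul, walsh_comm v, sum_walsh]
  split_ifs <;> simp

/-- Convolution theorem. Each sign vector is its own inverse, so `v * y` plays the role of `v⁻¹ *
y`. -/
theorem sum_walshCoeff_mul (f g : (I → ℤˣ) → ℝ) (y : I → ℤˣ) :
    ∑ v, walshCoeff f v * walshCoeff g (v * y) = walshCoeff (f * g) y := by
  have hpos : (2 : ℝ) ^ Fintype.card I ≠ 0 := by positivity
  have h1 : ∀ v : I → ℤˣ, walshCoeff f v * walshCoeff g (v * y) =
      ((2 : ℝ) ^ Fintype.card I)⁻¹ * ((2 : ℝ) ^ Fintype.card I)⁻¹ *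
        ∑ ε, ∑ ε', f ε * g ε' * walsh y ε' * walsh v (ε * ε') := by
    intro v
    rw [walshCoeff, walshCoeff, mul_mul_mul_comm, Finset.sum_mul_sum]
    congr 1
    refine Finset.sum_congr rfl fun ε _ => Finset.sum_congr rfl fun ε' _ => ?_
    rw [walsh_mul_left, walsh_mul_right]
    ring
  simp only [h1]
  rw [← Finset.mul_sum, Finset.sum_comm, walshCoeff, mul_assoc]
  congr 1
  rw [Finset.mul_sum]
  refine Finset.sum_congr rfl fun ε _ => ?_
  rw [Finset.sum_comm]
  simp only [← Finset.mul_sum, sum_walsh, sign_mul_eq_one_iff]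
  simp only [mul_ite, mul_zero, Finset.sum_ite_eq', Finset.mem_univ, if_true, Pi.mul_apply]
  field_simp

theorem walshCoeff_comp_perm (f : (I → ℤˣ) → ℝ) (π : Equiv.Perm I) (v : I → ℤˣ) :
    walshCoeff f (v ∘ π) = walshCoeff (fun ε => f (ε ∘ π)) v := by
  rw [walshCoeff, walshCoeff]
  congr 1
  refine (Fintype.sum_equiv (Equiv.arrowCongr π.symm (Equiv.refl ℤˣ)) _ _ fun ε => ?_).symm
  change _ = f (ε ∘ π) * walsh (v ∘ π) (ε ∘ π)
  rw [walsh_comp_perm]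

theorem sum_eq_zero_of_flip {f : (I → ℤˣ) → ℝ} (i : I)
    (h : ∀ ε, f (ε * Pi.mulSingle i (-1)) = - f ε) : ∑ ε, f ε = 0 := by
  have h1 := Equiv.sum_comp (Equiv.mulRight (Pi.mulSingle i (-1) : I → ℤˣ)) f
  simp only [Equiv.coe_mulRight, h, Finset.sum_neg_distrib] at h1
  linarith

/-- Flipping the sign at `i` preserves `f` and negates the Walsh function of `v`, so the terms
cancel. Thus a function of the signs in `J` has its Walsh expansion supported on `v` trivial off
`J`. -/
theorem walshCoeff_eq_zero {f : (I → ℤˣ) → ℝ} {v : I → ℤˣ} {i : I}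
    (hf : ∀ ε, f (ε * Pi.mulSingle i (-1)) = f ε) (hv : v i ≠ 1) : walshCoeff f v = 0 := by
  rw [walshCoeff, sum_eq_zero_of_flip i, mul_zero]
  intro ε
  have h : walsh v (Pi.mulSingle i (-1)) = -1 := by
    rw [walsh, Finset.prod_eq_single i]
    · rw [(Int.units_eq_one_or _).resolve_left hv]
      simp [signPairing]
    · intro j _ hj
      rw [Pi.mulSingle_eq_of_ne hj, signPairing_comm, signPairing, if_neg (by decide)]
    · simp
  rw [hf, walsh_mul_right, h]
  ring

end Walsh

/-! ### The majority function -/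

section Majority

variable {I : Type*}

/-- The sum of the signs indexed by `J`. -/
def signSum (J : Finset I) (ε : I → ℤˣ) : ℤ := ∑ i ∈ J, (ε i : ℤ)

/-- The sign of the sum of the signs indexed by `J`. -/
def partialMajority (J : Finset I) (ε : I → ℤˣ) : ℝ := (signSum J ε).sign

/-- The majority function, with ties decided by the sign at `i₀`. -/
def majority [Fintype I] (i₀ : I) (ε : I → ℤˣ) : ℝ :=
  (2 * signSum Finset.univ ε + ε i₀ : ℤ).sign

theorem partialMajority_comp_perm (J : Finset I) (π : Equiv.Perm I) (ε : I → ℤˣ) :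
    partialMajority J (ε ∘ π) = partialMajority (J.map π.toEmbedding) ε := by
  simp [partialMajority, signSum]

theorem partialMajority_mul_mulSingle [DecidableEq I] {J : Finset I} {i : I} (hi : i ∉ J)
    (ε : I → ℤˣ) :
    partialMajority J (ε * Pi.mulSingle i (-1)) = partialMajority J ε := by
  have : signSum J (ε * Pi.mulSingle i (-1)) = signSum J ε := by
    refine Finset.sum_congr rfl fun j hj => ?_
    rw [Pi.mul_apply, Pi.mulSingle_eq_of_ne (show j ≠ i from fun h => hi (h ▸ hj)), mul_one]
  rw [partialMajority, this, partialMajority]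

variable [Fintype I]

/-- Twice the sum plus a sign is odd, so it never vanishes; this is the purpose of the tie-breaking
term. -/
theorem majority_sq (i₀ : I) (ε : I → ℤˣ) : majority i₀ ε ^ 2 = 1 := by
  have h : (2 * signSum Finset.univ ε + ε i₀ : ℤ) ≠ 0 := by
    rcases Int.units_eq_one_or (ε i₀) with h | h <;> rw [h] <;> push_cast <;> omega
  rw [majority]
  rcases lt_or_gt_of_ne h with h | h
  · rw [Int.sign_eq_neg_one_of_neg h]
    norm_num
  · rw [Int.sign_eq_one_of_pos h]
    norm_num

theorem majority_neg (i₀ : I) (ε : I → ℤˣ) : majority i₀ (-ε) = -majority i₀ ε := by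
  have h : (2 * signSum Finset.univ (-ε) + (-ε) i₀ : ℤ) =
      -(2 * signSum Finset.univ ε + ε i₀) := by
    simp only [signSum, Pi.neg_apply, Units.val_neg, Finset.sum_neg_distrib]
    ring
  rw [majority, h, Int.sign_neg, majority]
  push_cast
  rfl

variable [DecidableEq I]

theorem sum_majority (i₀ : I) : ∑ ε, majority i₀ ε = 0 := by
  have h1 := Equiv.sum_comp (Equiv.neg (I → ℤˣ)) (majority i₀)
  simp only [Equiv.neg_apply, majority_neg, Finset.sum_neg_distrib] at h1
  linarith

/-- Variance of a sum of independent signs: the cross terms cancel under a flip of one coordinate.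
-/
theorem sum_sq_signSum (D : Finset I) :
    ∑ ε : I → ℤˣ, ((signSum D ε : ℤ) : ℝ) ^ 2 = 2 ^ Fintype.card I * D.card := by
  have h1 : ∀ ε : I → ℤˣ, ((signSum D ε : ℤ) : ℝ) ^ 2 =
      ∑ i ∈ D, ∑ j ∈ D, ((ε i : ℤ) : ℝ) * ((ε j : ℤ) : ℝ) := by
    intro ε
    rw [signSum, sq]
    push_cast
    rw [Finset.sum_mul_sum]
  have h2 : ∀ i j : I, ∑ ε : I → ℤˣ, ((ε i : ℤ) : ℝ) * ((ε j : ℤ) : ℝ) =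
      if i = j then 2 ^ Fintype.card I else 0 := by
    intro i j
    split_ifs with hij
    · subst hij
      have : ∀ ε : I → ℤˣ, ((ε i : ℤ) : ℝ) * ((ε i : ℤ) : ℝ) = 1 := by
        intro ε
        rcases Int.units_eq_one_or (ε i) with h | h <;> simp [h]
      simp [this]
    · refine sum_eq_zero_of_flip i fun ε => ?_
      rw [Pi.mul_apply, Pi.mul_apply, Pi.mulSingle_eq_same, Pi.mulSingle_eq_of_ne (Ne.symm hij)]
      simp
  simp only [h1]
  rw [Finset.sum_comm]
  simp_rw [Finset.sum_comm (s := Finset.univ) (t := D), h2]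
  simp [mul_comm]

/-- The factor `2 * a + 1` makes the induction close, through `(2a+1)(2a+3) ≤ (2a+2)²`. -/
theorem centralBinom_sq_mul_le (a : ℕ) : a.centralBinom ^ 2 * (2 * a + 1) ≤ 16 ^ a := by
  induction a with
  | zero => simp
  | succ a ih =>
    have h := Nat.succ_mul_centralBinom_succ a
    have h2 : (a + 1) ^ 2 * ((a + 1).centralBinom ^ 2 * (2 * (a + 1) + 1)) ≤
        (a + 1) ^ 2 * 16 ^ (a + 1) := by
      calc (a + 1) ^ 2 * ((a + 1).centralBinom ^ 2 * (2 * (a + 1) + 1))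
          = ((a + 1) * (a + 1).centralBinom) ^ 2 * (2 * a + 3) := by ring
        _ = (a.centralBinom ^ 2 * (2 * a + 1)) * (4 * ((2 * a + 1) * (2 * a + 3))) := by
            rw [h]; ring
        _ ≤ 16 ^ a * (4 * (4 * (a + 1) ^ 2)) :=
            Nat.mul_le_mul ih (Nat.mul_le_mul_left _ (by nlinarith))
        _ = (a + 1) ^ 2 * 16 ^ (a + 1) := by ring
    exact Nat.le_of_mul_le_mul_left h2 (by positivity)

theorem choose_middle_sq_mul_le (n : ℕ) : n.choose (n / 2) ^ 2 * n ≤ 4 ^ n := by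
  obtain ⟨a, rfl | rfl⟩ := Nat.even_or_odd' n
  · have h := centralBinom_sq_mul_le a
    rw [Nat.mul_div_cancel_left _ two_pos, ← Nat.centralBinom_eq_two_mul_choose, pow_mul]
    norm_num
    nlinarith
  · have h := centralBinom_sq_mul_le (a + 1)
    have h1 : (a + 1).centralBinom = 2 * (2 * a + 1).choose a := by
      rw [Nat.centralBinom_eq_two_mul_choose, show 2 * (a + 1) = 2 * a + 1 + 1 by ring,
        Nat.choose_succ_succ, Nat.choose_symm_half]
      ring
    rw [show (2 * a + 1) / 2 = a by omega]
    rw [h1] at h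
    have h2 : 16 ^ (a + 1) = 4 * 4 ^ (2 * a + 1) := by
      rw [show 16 = 4 ^ 2 by norm_num, ← pow_mul, show 2 * (a + 1) = 2 * a + 1 + 1 by ring]
      ring
    rw [h2] at h
    nlinarith [sq_nonneg ((2 * a + 1).choose a)]

theorem card_signSum_eq_le (t : ℤ) :
    (Finset.univ.filter fun ε : I → ℤˣ => signSum Finset.univ ε = t).card ≤
      (Fintype.card I).choose (Fintype.card I / 2) := by
  have hsum : ∀ ε : I → ℤˣ, signSum Finset.univ ε =
      Fintype.card I - 2 * (Finset.univ.filter fun i => ε i = -1).card := by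
    intro ε
    have : ∀ i, ((ε i : ℤˣ) : ℤ) = 1 - 2 * if ε i = -1 then 1 else 0 := by
      intro i
      rcases Int.units_eq_one_or (ε i) with h | h <;> rw [h] <;> decide
    simp only [signSum, this, Finset.sum_sub_distrib, ← Finset.mul_sum, Finset.sum_boole]
    simp
  -- A sum equal to `t` means exactly `(n - t) / 2` minus signs. For impossible `t` the fibre is
  -- empty, so rounding and truncation do no harm.
  refine le_trans ?_ (Nat.choose_le_middle ((Fintype.card I - t) / 2).toNat _)
  rw [← Finset.card_univ (α := I), ← Finset.card_powersetCard]
  refine Finset.card_le_card_of_injOn (fun ε => Finset.univ.filter fun i => ε i = -1) ?_ ?_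
  · intro ε hε
    have h1 : signSum Finset.univ ε = t := by simpa using hε
    rw [hsum] at h1
    refine Finset.mem_coe.2 (Finset.mem_powersetCard.2 ⟨Finset.subset_univ _, ?_⟩)
    simp only [Finset.card_univ]
    omega
  · intro ε _ ε' _ h
    funext i
    have h1 := Finset.ext_iff.1 h i
    simp only [Finset.mem_filter, Finset.mem_univ, true_and] at h1
    rcases Int.units_eq_one_or (ε i) with h2 | h2 <;>
      rcases Int.units_eq_one_or (ε' i) with h3 | h3 <;> rw [h2, h3] at h1 ⊢
    · exact (by decide : ¬((1 : ℤˣ) = -1 ↔ (-1 : ℤˣ) = -1)) h1 |>.elim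
    · exact (by decide : ¬((-1 : ℤˣ) = -1 ↔ (1 : ℤˣ) = -1)) h1 |>.elim

theorem card_abs_signSum_le (k : ℕ) :
    (Finset.univ.filter fun ε : I → ℤˣ => |signSum Finset.univ ε| ≤ k).card ≤
      (2 * k + 1) * (Fintype.card I).choose (Fintype.card I / 2) := by
  have h1 : (Finset.univ.filter fun ε : I → ℤˣ => |signSum Finset.univ ε| ≤ k) =
      (Finset.Icc (-k : ℤ) k).biUnion fun t =>
        Finset.univ.filter fun ε : I → ℤˣ => signSum Finset.univ ε = t := by
    ext ε
    simp [abs_le]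
  rw [h1]
  refine Finset.card_biUnion_le.trans ((Finset.sum_le_sum fun t _ => card_signSum_eq_le t).trans ?_)
  rw [Finset.sum_const, Int.card_Icc, smul_eq_mul]
  exact Nat.mul_le_mul_right _ (by omega)

/-- Chebyshev's inequality; integrality improves the threshold `k` to `k + 1`. -/
theorem card_lt_abs_signSum_le (D : Finset I) (k : ℕ) :
    ((Finset.univ.filter fun ε : I → ℤˣ => (k : ℤ) < |signSum D ε|).card : ℝ) * (k + 1) ^ 2 ≤
      2 ^ Fintype.card I * D.card := by
  rw [← sum_sq_signSum, ← nsmul_eq_mul, ← Finset.sum_const]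
  refine (Finset.sum_le_sum fun ε hε => ?_).trans
    (Finset.sum_le_sum_of_subset_of_nonneg (Finset.filter_subset _ _) fun ε _ _ => sq_nonneg _)
  have h1 : ((k : ℤ) + 1) ≤ |signSum D ε| := (Finset.mem_filter.1 hε).2
  have h2 : ((k : ℝ) + 1) ≤ |((signSum D ε : ℤ) : ℝ)| := by exact_mod_cast h1
  rw [← sq_abs ((signSum D ε : ℤ) : ℝ)]
  gcongr

theorem majority_eq_partialMajority (i₀ : I) (J : Finset I) (ε : I → ℤˣ) {k : ℕ}
    (h1 : (k : ℤ) < |signSum Finset.univ ε|) (h2 : |signSum Jᶜ ε| ≤ k) :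
    majority i₀ ε = partialMajority J ε := by
  have hadd : signSum J ε + signSum Jᶜ ε = signSum Finset.univ ε := Finset.sum_add_sum_compl J _
  have hunit : |((ε i₀ : ℤˣ) : ℤ)| ≤ 1 := by
    rcases Int.units_eq_one_or (ε i₀) with h | h <;> simp [h]
  rw [majority, partialMajority]
  rw [abs_le] at h2 hunit
  congr 1
  rcases lt_abs.1 h1 with h | h
  · rw [Int.sign_eq_one_of_pos (by omega), Int.sign_eq_one_of_pos (by omega)]
  · rw [Int.sign_eq_neg_one_of_neg (by omega), Int.sign_eq_neg_one_of_neg (by omega)]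

/-- The majority function is close in mean square to the majority over most of the indices. -/
theorem sum_sq_majority_sub_le (i₀ : I) (J : Finset I) {η : ℝ} (hη : 0 < η)
    (hn : 1 ≤ η ^ 2 * Fintype.card I) (hJ : (1 - η ^ 3) * Fintype.card I ≤ J.card) :
    ((2 : ℝ) ^ Fintype.card I)⁻¹ * ∑ ε, (majority i₀ - partialMajority J) ε ^ 2 ≤ 16 * η := by
  set n := Fintype.card I with hndef
  have hnpos : (0 : ℝ) < n := by
    by_contra h
    nlinarith [sq_nonneg η]
  set q := Real.sqrt n with hq
  have hqpos : 0 < q := Real.sqrt_pos.2 hnpos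
  have hqq : q ^ 2 = n := Real.sq_sqrt hnpos.le
  have hηq : 1 ≤ η * q := by
    by_contra! h
    have : (η * q) ^ 2 < 1 := by nlinarith [mul_pos hη hqpos]
    nlinarith
  -- The threshold is `η √n`: a fraction `η` of the typical size of the full sum, but well above the
  -- typical size `η^(3/2) √n` of the sum over the complement of `J`.
  set k := ⌊η * q⌋₊ with hk
  have hk1 : (k : ℝ) ≤ η * q := Nat.floor_le (by positivity)
  have hk2 : η * q < k + 1 := Nat.lt_floor_add_one _
  let B1 := Finset.univ.filter fun ε : I → ℤˣ => |signSum Finset.univ ε| ≤ k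
  let B2 := Finset.univ.filter fun ε : I → ℤˣ => (k : ℤ) < |signSum Jᶜ ε|
  have hpow : (0 : ℝ) < 2 ^ n := by positivity
  have hB1 : (B1.card : ℝ) ≤ 3 * η * 2 ^ n := by
    have h1 : (B1.card : ℝ) ≤ (2 * k + 1) * (n.choose (n / 2) : ℝ) := by
      exact_mod_cast card_abs_signSum_le (I := I) k
    have h2 : (n.choose (n / 2) : ℝ) * q ≤ 2 ^ n := by
      refine le_of_sq_le_sq ?_ hpow.le
      rw [mul_pow, hqq, ← pow_mul, mul_comm n 2, pow_mul]
      norm_num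
      exact_mod_cast choose_middle_sq_mul_le n
    calc (B1.card : ℝ) ≤ (2 * k + 1) * (n.choose (n / 2) : ℝ) := h1
      _ ≤ (3 * (η * q)) * (n.choose (n / 2) : ℝ) := by gcongr; linarith
      _ = 3 * η * ((n.choose (n / 2) : ℝ) * q) := by ring
      _ ≤ 3 * η * 2 ^ n := by gcongr
  have hB2 : (B2.card : ℝ) ≤ η * 2 ^ n := by
    have h1 := card_lt_abs_signSum_le Jᶜ k
    have h2 : (Jᶜ.card : ℝ) ≤ η ^ 3 * n := by
      have : (J.card : ℝ) + Jᶜ.card = n := by exact_mod_cast Finset.card_add_card_compl J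
      linarith
    have h3 : (B2.card : ℝ) * (η ^ 2 * n) ≤ (η * 2 ^ n) * (η ^ 2 * n) := by
      calc (B2.card : ℝ) * (η ^ 2 * n) = (B2.card : ℝ) * (η * q) ^ 2 := by
            rw [mul_pow, hqq]
        _ ≤ (B2.card : ℝ) * (k + 1) ^ 2 := by gcongr
        _ ≤ 2 ^ n * (Jᶜ.card : ℝ) := h1
        _ ≤ 2 ^ n * (η ^ 3 * n) := by gcongr
        _ = _ := by ring
    exact le_of_mul_le_mul_right h3 (by positivity)
  -- The functions agree off `B1 ∪ B2`, which has proportion at most `3η + η`. On it the squared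
  -- difference is at most 4, whence `16 * η`.
  have hbound : ∀ ε : I → ℤˣ, (majority i₀ - partialMajority J) ε ^ 2 ≤
      if ε ∈ B1 ∪ B2 then 4 else 0 := by
    intro ε
    split_ifs with h
    · have h1 : |majority i₀ ε| ≤ 1 := (sq_le_one_iff_abs_le_one _).1 (majority_sq i₀ ε).le
      have h2 : |partialMajority J ε| ≤ 1 := by
        rw [partialMajority]
        rcases Int.sign_trichotomy (signSum J ε) with h | h | h <;> rw [h] <;> norm_num
      rw [abs_le] at h1 h2
      rw [Pi.sub_apply]
      nlinarith
    · simp only [B1, B2, Finset.mem_union, Finset.mem_filter, Finset.mem_univ, true_and,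
        not_or, not_le, not_lt] at h
      rw [Pi.sub_apply, majority_eq_partialMajority i₀ J ε h.1 h.2]
      simp
  have hsum : ∑ ε, (majority i₀ - partialMajority J) ε ^ 2 ≤ 16 * η * 2 ^ n := by
    refine (Finset.sum_le_sum fun ε _ => hbound ε).trans ?_
    rw [Finset.sum_ite_mem, Finset.univ_inter, Finset.sum_const, nsmul_eq_mul]
    have : ((B1 ∪ B2).card : ℝ) ≤ B1.card + B2.card := by
      exact_mod_cast Finset.card_union_le B1 B2
    linarith
  rw [inv_mul_le_iff₀ hpow]
  linarith

end Majority

/-! ### The regular representations -/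

section Regular

variable {G : Type*}

open Classical in
/-- The basis vector of `ℓ²(G)` at `g`. -/
noncomputable def basisVector (g : G) : lp (fun _ : G => ℂ) 2 := lp.single 2 g 1

theorem basisVector_apply_self (g : G) : basisVector g g = 1 := by
  classical
  exact lp.single_apply_self 2 g _

theorem basisVector_apply_ne {g h : G} (hne : h ≠ g) : basisVector g h = 0 := by
  classical
  exact lp.single_apply_ne 2 g _ hne

theorem inner_basisVector_left (g : G) (f : lp (fun _ : G => ℂ) 2) :
    inner ℂ (basisVector g) f = f g := by
  classical
  rw [basisVector, lp.inner_single_left]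
  simp

theorem inner_basisVector_right (g : G) (f : lp (fun _ : G => ℂ) 2) :
    inner ℂ f (basisVector g) = star (f g) := by
  rw [← inner_conj_symm, inner_basisVector_left]
  rfl

theorem orthonormal_basisVector : Orthonormal ℂ (basisVector : G → lp (fun _ : G => ℂ) 2) := by
  classical
  rw [orthonormal_iff_ite]
  intro g h
  rw [inner_basisVector_left]
  split_ifs with hgh
  · rw [hgh, basisVector_apply_self]
  · exact basisVector_apply_ne hgh

theorem hasSum_basisVector (f : lp (fun _ : G => ℂ) 2) :
    HasSum (fun g => f g • basisVector g) f := by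
  classical
  have h := lp.hasSum_single (p := 2) (by norm_num) f
  convert! h using 2 with g
  rw [basisVector, ← lp.single_smul, smul_eq_mul, mul_one]

variable [Group G]

/-- The right regular representation on `ℓ²(G)`: `(ρ_g f)(h) = f(h g)`. -/
noncomputable def rightRegular (g : G) : lp (fun _ : G => ℂ) 2 →ₗᵢ[ℂ] lp (fun _ : G => ℂ) 2 where
  toFun f := ⟨fun h => f (h * g), memℓp_gen
    ((Equiv.mulRight g).summable_iff.2 ((lp.memℓp f).summable (by norm_num)))⟩
  map_add' _ _ := rfl
  map_smul' _ _ := rfl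
  norm_map' f := by
    rw [lp.norm_eq_tsum_rpow (by norm_num), lp.norm_eq_tsum_rpow (by norm_num)]
    exact congrArg (· ^ _) ((Equiv.mulRight g).tsum_eq
      (fun h => ‖f h‖ ^ (2 : ENNReal).toReal))

theorem leftRegular_apply (g h : G) (f : lp (fun _ : G => ℂ) 2) :
    leftRegular g f h = f (g⁻¹ * h) :=
  rfl

theorem rightRegular_apply (g h : G) (f : lp (fun _ : G => ℂ) 2) :
    rightRegular g f h = f (h * g) :=
  rfl

theorem leftRegular_basisVector (g h : G) :
    leftRegular g (basisVector h) = basisVector (g * h) := by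
  ext k
  rw [leftRegular_apply]
  by_cases hk : k = g * h
  · rw [hk, inv_mul_cancel_left, basisVector_apply_self, basisVector_apply_self]
  · rw [basisVector_apply_ne hk, basisVector_apply_ne]
    rintro rfl
    exact hk (mul_inv_cancel_left _ _).symm

theorem rightRegular_basisVector (g h : G) :
    rightRegular g (basisVector h) = basisVector (h * g⁻¹) := by
  ext k
  rw [rightRegular_apply]
  by_cases hk : k = h * g⁻¹
  · rw [hk, inv_mul_cancel_right, basisVector_apply_self, basisVector_apply_self]
  · rw [basisVector_apply_ne hk, basisVector_apply_ne]
    rintro rfl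
    exact hk (mul_inv_cancel_right _ _).symm

theorem star_leftRegular (g : G) :
    star (leftRegular g).toContinuousLinearMap = (leftRegular g⁻¹).toContinuousLinearMap := by
  rw [ContinuousLinearMap.star_eq_adjoint, eq_comm, ContinuousLinearMap.eq_adjoint_iff]
  intro x y
  change inner ℂ (leftRegular g⁻¹ x) y = inner ℂ x (leftRegular g y)
  rw [← (leftRegular g).inner_map_map]
  congr 1
  ext h
  rw [leftRegular_apply, leftRegular_apply, inv_inv, mul_inv_cancel_left]

theorem leftRegular_mem (g : G) :
    (leftRegular g).toContinuousLinearMap ∈ (groupVonNeumannAlgebra G).toStarSubalgebra := by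
  change _ ∈ StarSubalgebra.centralizer ℂ _
  rw [StarSubalgebra.mem_centralizer_iff]
  intro a ha
  have ha' := (StarSubalgebra.mem_centralizer_iff ℂ).1 ha
  have ha'' := (StarSubalgebra.mem_centralizer_iff ℂ).1 (star_mem ha)
  exact ⟨(ha' _ ⟨g, rfl⟩).1.symm, (ha'' _ ⟨g, rfl⟩).1.symm⟩

theorem rightRegular_mem_centralizer (g : G) :
    (rightRegular g).toContinuousLinearMap ∈ StarSubalgebra.centralizer ℂ
      (Set.range fun g : G => (leftRegular g).toContinuousLinearMap) := by
  rw [StarSubalgebra.mem_centralizer_iff]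
  have h1 : ∀ h : G,
      (leftRegular h).toContinuousLinearMap * (rightRegular g).toContinuousLinearMap =
      (rightRegular g).toContinuousLinearMap * (leftRegular h).toContinuousLinearMap := by
    intro h
    ext f k
    change f (h⁻¹ * k * g) = f (h⁻¹ * (k * g))
    rw [mul_assoc]
  rintro _ ⟨h, rfl⟩
  refine ⟨h1 h, ?_⟩
  rw [star_leftRegular]
  exact h1 h⁻¹

end Regular

/-! ### The group von Neumann algebra in standard form -/

section GroupAlgebra

/-- The elements of the group von Neumann algebra. -/
abbrev GroupVN (G : Type*) [Group G] : Type _ := (groupVonNeumannAlgebra G).toStarSubalgebra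

variable {G : Type*} [Group G]

/-- The canonical unitaries of the group von Neumann algebra. -/
noncomputable def canonicalUnitary : G →* GroupVN G where
  toFun g := ⟨(leftRegular g).toContinuousLinearMap, leftRegular_mem g⟩
  map_one' := by
    ext f h
    change f (1⁻¹ * h) = f h
    rw [inv_one, one_mul]
  map_mul' g k := by
    ext f h
    change f ((g * k)⁻¹ * h) = f (k⁻¹ * (g⁻¹ * h))
    rw [mul_inv_rev, mul_assoc]

theorem star_canonicalUnitary (g : G) : star (canonicalUnitary g) = canonicalUnitary g⁻¹ :=
  Subtype.ext (star_leftRegular g)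

/-- The vector `a δ₁` of an element `a` of the group von Neumann algebra. -/
noncomputable def traceVector : GroupVN G →ₗ[ℂ] lp (fun _ : G => ℂ) 2 where
  toFun a := (a : lp (fun _ : G => ℂ) 2 →L[ℂ] lp (fun _ : G => ℂ) 2) (basisVector 1)
  map_add' _ _ := rfl
  map_smul' _ _ := rfl

theorem traceVector_mul (a b : GroupVN G) :
    traceVector (a * b) =
      (a : lp (fun _ : G => ℂ) 2 →L[ℂ] lp (fun _ : G => ℂ) 2) (traceVector b) :=
  rfl

theorem traceVector_one : traceVector (1 : GroupVN G) = basisVector 1 :=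
  rfl

theorem traceVector_canonicalUnitary (g : G) : traceVector (canonicalUnitary g) = basisVector g :=
  (leftRegular_basisVector g 1).trans (by rw [mul_one])

theorem traceVector_canonicalUnitary_mul (g : G) (a : GroupVN G) :
    traceVector (canonicalUnitary g * a) = leftRegular g (traceVector a) :=
  rfl

theorem apply_rightRegular (a : GroupVN G) (g : G) (f : lp (fun _ : G => ℂ) 2) :
    (a : lp (fun _ : G => ℂ) 2 →L[ℂ] lp (fun _ : G => ℂ) 2) (rightRegular g f) =
      rightRegular g ((a : lp (fun _ : G => ℂ) 2 →L[ℂ] lp (fun _ : G => ℂ) 2) f) := by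
  have h := ((StarSubalgebra.mem_centralizer_iff ℂ).1 a.2 _ (rightRegular_mem_centralizer g)).1
  exact (DFunLike.congr_fun h f).symm

theorem apply_basisVector (a : GroupVN G) (g : G) :
    (a : lp (fun _ : G => ℂ) 2 →L[ℂ] lp (fun _ : G => ℂ) 2) (basisVector g) =
      rightRegular g⁻¹ (traceVector a) := by
  have h := rightRegular_basisVector g⁻¹ 1
  rw [inv_inv, one_mul] at h
  rw [← h, apply_rightRegular]
  rfl

theorem traceVector_mul_canonicalUnitary (a : GroupVN G) (g : G) :
    traceVector (a * canonicalUnitary g) = rightRegular g⁻¹ (traceVector a) := by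
  rw [traceVector_mul, traceVector_canonicalUnitary, apply_basisVector]

/-- The algebra commutes with right translations, so `a δ₁` determines `a` on every basis vector. -/
theorem traceVector_injective : Function.Injective (traceVector : GroupVN G → _) := by
  intro a b hab
  refine Subtype.ext (ContinuousLinearMap.ext fun f => ?_)
  have ha := (hasSum_basisVector f).mapL (a : lp (fun _ : G => ℂ) 2 →L[ℂ] lp (fun _ : G => ℂ) 2)
  have hb := (hasSum_basisVector f).mapL (b : lp (fun _ : G => ℂ) 2 →L[ℂ] lp (fun _ : G => ℂ) 2)
  simp only [map_smul, apply_basisVector] at ha hb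
  rw [hab] at ha
  exact ha.unique hb

theorem inner_apply_left (a : GroupVN G) (x y : lp (fun _ : G => ℂ) 2) :
    inner ℂ (((star a : GroupVN G) : lp (fun _ : G => ℂ) 2 →L[ℂ] lp (fun _ : G => ℂ) 2) x) y =
      inner ℂ x ((a : lp (fun _ : G => ℂ) 2 →L[ℂ] lp (fun _ : G => ℂ) 2) y) :=
  ContinuousLinearMap.adjoint_inner_left _ _ _

theorem traceVector_star_apply (a : GroupVN G) (g : G) :
    traceVector (star a) g = star (traceVector a g⁻¹) := by
  have h := inner_apply_left a (basisVector 1) (basisVector g)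
  rw [inner_basisVector_right, inner_basisVector_left, apply_basisVector a, rightRegular_apply,
    one_mul] at h
  rw [← h, star_star]
  rfl

theorem groupTrace_eq (a : GroupVN G) : groupTrace G a = traceVector a 1 :=
  inner_basisVector_left 1 _

theorem groupTrace_mul (a b : GroupVN G) :
    groupTrace G (a * b) = inner ℂ (traceVector (star a)) (traceVector b) := by
  rw [groupTrace_eq, traceVector_mul, ← inner_basisVector_left, ← inner_apply_left]
  rfl

theorem groupTrace_star_mul_self (a : GroupVN G) :
    groupTrace G (star a * a) = ((‖traceVector a‖ ^ 2 : ℝ) : ℂ) := by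
  rw [groupTrace_mul, star_star, inner_self_eq_norm_sq_to_K]
  push_cast
  rfl

theorem traceNorm_groupTrace (a : GroupVN G) :
    traceNorm (groupVonNeumannAlgebra G) (groupTrace G) a = ‖traceVector a‖ := by
  rw [traceNorm, groupTrace_star_mul_self, Complex.ofReal_re, Real.sqrt_sq (norm_nonneg _)]

/-- The trace of a product is `∑ a(g⁻¹) b(g)`, which is symmetric under `g ↦ g⁻¹`. -/
theorem groupTrace_mul_comm (a b : GroupVN G) :
    groupTrace G (a * b) = groupTrace G (b * a) := by
  have h : ∀ a b : GroupVN G,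
      groupTrace G (a * b) = ∑' g, traceVector a g⁻¹ * traceVector b g := by
    intro a b
    rw [groupTrace_mul, lp.inner_eq_tsum]
    refine tsum_congr fun g => ?_
    rw [traceVector_star_apply, RCLike.inner_apply]
    simp [mul_comm]
  rw [h, h, ← (Equiv.inv G).tsum_eq]
  refine tsum_congr fun g => ?_
  simp [mul_comm]

theorem isFaithfulNormalTracialState_groupTrace :
    IsFaithfulNormalTracialState (groupVonNeumannAlgebra G) (groupTrace G) where
  map_one := by rw [groupTrace_eq, traceVector_one, basisVector_apply_self]
  nonneg a := by
    rw [groupTrace_star_mul_self]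
    exact ⟨by rw [Complex.ofReal_re]; positivity, Complex.ofReal_im _⟩
  faithful a h := by
    rw [groupTrace_star_mul_self] at h
    refine traceVector_injective ?_
    rw [map_zero]
    simpa using h
  tracial := groupTrace_mul_comm
  normal := by
    -- The trace is a vector state, so one nonzero term suffices.
    refine ⟨Pi.single 0 (basisVector 1), Pi.single 0 (basisVector 1), ?_, ?_, fun a => ?_⟩
    · refine summable_of_ne_finset_zero (s := {0}) fun n hn => ?_
      rw [Pi.single_eq_of_ne (by simpa using hn)]
      simp
    · refine summable_of_ne_finset_zero (s := {0}) fun n hn => ?_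
      rw [Pi.single_eq_of_ne (by simpa using hn)]
      simp
    · refine hasSum_single (0 : ℕ) fun n hn => ?_
      rw [Pi.single_eq_of_ne hn, inner_zero_left]

/-- The vector of a central element is constant on conjugacy classes and square-summable, so it
vanishes on infinite classes. -/
theorem IsICC.isFactor (hG : IsICC G) : IsFactor (groupVonNeumannAlgebra G) := by
  intro z hz hz'
  let z' : GroupVN G := ⟨z, hz⟩
  have hcomm : ∀ g, canonicalUnitary g * z' = z' * canonicalUnitary g := fun g =>
    Subtype.ext (VonNeumannAlgebra.mem_commutant_iff.1 hz' _ (leftRegular_mem g))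
  have hconj : ∀ g h, traceVector z' (g * h * g⁻¹) = traceVector z' h := by
    intro g h
    have h1 := congrArg (fun a => traceVector a (g * h)) (hcomm g)
    simp only [traceVector_canonicalUnitary_mul, traceVector_mul_canonicalUnitary,
      leftRegular_apply, rightRegular_apply, inv_mul_cancel_left] at h1
    exact h1.symm
  have hzero : ∀ h, h ≠ 1 → traceVector z' h = 0 := by
    intro h hh
    by_contra hne
    have hsum := (lp.memℓp (traceVector z')).summable (by norm_num)
    have hlt := hsum.tendsto_cofinite_zero.eventually
      (gt_mem_nhds (show 0 < ‖traceVector z' h‖ ^ (2 : ENNReal).toReal by positivity))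
    refine hG h hh (Set.Finite.subset hlt fun k hk => ?_)
    obtain ⟨g, rfl⟩ := isConj_iff.1 hk
    change ¬ (‖traceVector z' (g * h * g⁻¹)‖ ^ (2 : ENNReal).toReal < _)
    rw [hconj]
    exact lt_irrefl _
  refine ⟨traceVector z' 1, ?_⟩
  have : z' = traceVector z' 1 • (1 : GroupVN G) := by
    refine traceVector_injective ?_
    rw [map_smul, traceVector_one]
    ext h
    by_cases hh : h = 1
    · rw [hh, lp.coeFn_smul, Pi.smul_apply, basisVector_apply_self, smul_eq_mul, mul_one]
    · rw [hzero h hh, lp.coeFn_smul, Pi.smul_apply, basisVector_apply_ne hh, smul_zero]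
  exact congrArg Subtype.val this

theorem not_finiteDimensional_groupVN [Infinite G] : ¬ FiniteDimensional ℂ (GroupVN G) := by
  intro hfin
  have h : LinearIndependent ℂ (canonicalUnitary : G → GroupVN G) := by
    refine LinearIndependent.of_comp traceVector ?_
    have h1 : traceVector ∘ (canonicalUnitary : G → GroupVN G) = basisVector :=
      funext traceVector_canonicalUnitary
    rw [h1]
    exact orthonormal_basisVector.linearIndependent
  exact Infinite.not_finite h.finite_of_isNoetherian

theorem IsICC.isIIOneFactor [Infinite G] (hG : IsICC G) :
    IsIIOneFactor (groupVonNeumannAlgebra G) (groupTrace G) :=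
  ⟨hG.isFactor, not_finiteDimensional_groupVN, isFaithfulNormalTracialState_groupTrace⟩

/-! ### Reduction of property Gamma to group elements -/

theorem norm_traceVector_unitary_mul {u : GroupVN G} (hu : u ∈ unitary (GroupVN G))
    (a : GroupVN G) : ‖traceVector (u * a)‖ = ‖traceVector a‖ := by
  rw [← traceNorm_groupTrace, ← traceNorm_groupTrace, traceNorm, traceNorm, star_mul, mul_assoc,
    ← mul_assoc (star u), Unitary.star_mul_self_of_mem hu, one_mul]

theorem norm_traceVector_mul_unitary {u : GroupVN G} (hu : u ∈ unitary (GroupVN G))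
    (a : GroupVN G) : ‖traceVector (a * u)‖ = ‖traceVector a‖ := by
  rw [← traceNorm_groupTrace, ← traceNorm_groupTrace, traceNorm, traceNorm, star_mul, mul_assoc,
    groupTrace_mul_comm, mul_assoc, mul_assoc, Unitary.mul_star_self_of_mem hu, mul_one]

theorem exists_norm_traceVector_sub_lt (a : GroupVN G) {ε : ℝ} (hε : 0 < ε) :
    ∃ (s : Finset G) (c : G → ℂ),
      ‖traceVector (a - ∑ g ∈ s, c g • canonicalUnitary g)‖ < ε := by
  obtain ⟨s, hs⟩ := ((hasSum_basisVector (traceVector a)).eventually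
    (Metric.ball_mem_nhds _ hε)).exists
  refine ⟨s, traceVector a, ?_⟩
  rw [map_sub, map_sum]
  simp only [map_smul, traceVector_canonicalUnitary]
  rw [← dist_eq_norm, dist_comm]
  exact hs

theorem norm_traceVector_commutator_sum_le (u : GroupVN G) (s : Finset G) (c : G → ℂ) {η : ℝ}
    (h : ∀ g ∈ s, ‖traceVector (canonicalUnitary g * u - u * canonicalUnitary g)‖ < η) :
    ‖traceVector ((∑ g ∈ s, c g • canonicalUnitary g) * u -
      u * ∑ g ∈ s, c g • canonicalUnitary g)‖ ≤ (∑ g ∈ s, ‖c g‖) * η := by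
  have hexp : (∑ g ∈ s, c g • canonicalUnitary g) * u - u * ∑ g ∈ s, c g • canonicalUnitary g =
      ∑ g ∈ s, c g • (canonicalUnitary g * u - u * canonicalUnitary g) := by
    simp only [Finset.sum_mul, Finset.mul_sum, ← Finset.sum_sub_distrib, smul_sub,
      smul_mul_assoc, mul_smul_comm]
  rw [hexp, map_sum, Finset.sum_mul]
  refine (norm_sum_le _ _).trans (Finset.sum_le_sum fun g hg => ?_)
  rw [map_smul, norm_smul]
  exact mul_le_mul_of_nonneg_left (h g hg).le (norm_nonneg _)

/-- Multiplication by a unitary on either side preserves the trace norm, so replacing `a` by `b`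
costs the same for every `u`. -/
theorem norm_traceVector_commutator_le {u : GroupVN G} (hu : u ∈ unitary (GroupVN G))
    (a b : GroupVN G) : ‖traceVector (a * u - u * a)‖ ≤
      2 * ‖traceVector (a - b)‖ + ‖traceVector (b * u - u * b)‖ := by
  have hsplit : a * u - u * a = (a - b) * u - u * (a - b) + (b * u - u * b) := by
    rw [sub_mul, mul_sub]
    abel
  rw [hsplit, map_add, map_sub]
  refine (norm_add_le _ _).trans (add_le_add_left ((norm_sub_le _ _).trans ?_) _)
  rw [norm_traceVector_mul_unitary hu, norm_traceVector_unitary_mul hu, two_mul]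

/-- To verify property Gamma it suffices to find unitaries almost commuting with finitely many
group elements. -/
theorem IsICC.hasPropertyGamma [Infinite G] (hG : IsICC G)
    (h : ∀ (S : Finset G) (ε : ℝ), 0 < ε → ∃ u ∈ unitary (GroupVN G), groupTrace G u = 0 ∧
      ∀ g ∈ S, ‖traceVector (canonicalUnitary g * u - u * canonicalUnitary g)‖ < ε) :
    HasPropertyGamma G := by
  classical
  refine ⟨hG, hG.isIIOneFactor, fun ε hε Ω => ?_⟩
  choose s c hc using fun a : GroupVN G =>
    exists_norm_traceVector_sub_lt a (show 0 < ε / 4 by positivity)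
  let K : ℝ := ∑ a ∈ Ω, ∑ g ∈ s a, ‖c a g‖
  have hK : 0 ≤ K := Finset.sum_nonneg fun _ _ => Finset.sum_nonneg fun _ _ => norm_nonneg _
  have hη : 0 < ε / (4 * (K + 1)) := by positivity
  obtain ⟨u, hu, hu0, hcomm⟩ := h (Ω.biUnion s) _ hη
  refine ⟨u, hu, hu0, fun a ha => ?_⟩
  rw [traceNorm_groupTrace]
  have h1 := norm_traceVector_commutator_le hu a (∑ g ∈ s a, c a g • canonicalUnitary g)
  have h2 := norm_traceVector_commutator_sum_le u (s a) (c a)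
    fun g hg => hcomm g (Finset.mem_biUnion.2 ⟨a, ha, hg⟩)
  have h3 : ∑ g ∈ s a, ‖c a g‖ ≤ K + 1 :=
    (Finset.single_le_sum (f := fun a => ∑ g ∈ s a, ‖c a g‖)
      (fun _ _ => Finset.sum_nonneg fun _ _ => norm_nonneg _) ha).trans (by linarith)
  have h4 : (∑ g ∈ s a, ‖c a g‖) * (ε / (4 * (K + 1))) ≤ ε / 4 :=
    (mul_le_mul_of_nonneg_right h3 hη.le).trans_eq (by field_simp)
  linarith [hc a]

end GroupAlgebra

/-! ### Walsh expansions in the group von Neumann algebra -/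

section WalshElement

variable {G : Type*} [Group G] {I : Type*} [Fintype I] [DecidableEq I]

/-- The image of a function of independent signs in the group von Neumann algebra, where the signs
are replaced by commuting involutions. -/
noncomputable def walshElement (h : (I → ℤˣ) →* G) (f : (I → ℤˣ) → ℝ) : GroupVN G :=
  ∑ v, (walshCoeff f v : ℂ) • canonicalUnitary (h v)

variable (h : (I → ℤˣ) →* G)

theorem walshElement_sub (f g : (I → ℤˣ) → ℝ) :
    walshElement h (f - g) = walshElement h f - walshElement h g := by
  rw [walshElement, walshElement, walshElement, ← Finset.sum_sub_distrib]
  refine Finset.sum_congr rfl fun v _ => ?_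
  rw [walshCoeff_sub, Complex.ofReal_sub, sub_smul]

theorem walshElement_one : walshElement h 1 = 1 := by
  rw [walshElement, Finset.sum_eq_single 1]
  · rw [walshCoeff_one, if_pos rfl, map_one, map_one, Complex.ofReal_one, one_smul]
  · intro v _ hv
    rw [walshCoeff_one, if_neg hv, Complex.ofReal_zero, zero_smul]
  · intro hv
    exact (hv (Finset.mem_univ _)).elim

theorem star_walshElement (f : (I → ℤˣ) → ℝ) : star (walshElement h f) = walshElement h f := by
  rw [walshElement, star_sum]
  refine Finset.sum_congr rfl fun v _ => ?_
  rw [star_smul, star_canonicalUnitary, ← map_inv,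
    show v⁻¹ = v from funext fun i => Int.units_inv_eq_self _]
  congr 1
  exact Complex.conj_ofReal _

theorem walshElement_mul (f g : (I → ℤˣ) → ℝ) :
    walshElement h f * walshElement h g = walshElement h (f * g) := by
  have h1 : ∀ v, (walshCoeff f v : ℂ) • canonicalUnitary (h v) * walshElement h g =
      ∑ y, ((walshCoeff f v * walshCoeff g (v * y) : ℝ) : ℂ) • canonicalUnitary (h y) := by
    intro v
    rw [walshElement, Finset.mul_sum, ← Equiv.sum_comp (Equiv.mulLeft v)]
    refine Finset.sum_congr rfl fun y _ => ?_
    rw [Equiv.coe_mulLeft, smul_mul_smul_comm, ← map_mul, ← map_mul, ← mul_assoc,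
      (sign_mul_eq_one_iff v v).2 rfl, one_mul, Complex.ofReal_mul]
  rw [walshElement, Finset.sum_mul, Finset.sum_congr rfl fun v _ => h1 v, Finset.sum_comm,
    walshElement]
  refine Finset.sum_congr rfl fun y _ => ?_
  rw [← Finset.sum_smul, ← Complex.ofReal_sum, sum_walshCoeff_mul]

theorem walshElement_mem_unitary {f : (I → ℤˣ) → ℝ} (hf : ∀ ε, f ε ^ 2 = 1) :
    walshElement h f ∈ unitary (GroupVN G) := by
  have h1 : walshElement h f * walshElement h f = 1 := by
    rw [walshElement_mul, ← walshElement_one h]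
    congr 1
    funext ε
    rw [Pi.mul_apply, ← sq, hf, Pi.one_apply]
  rw [Unitary.mem_iff, star_walshElement]
  exact ⟨h1, h1⟩

variable {h}

theorem traceVector_walshElement (f : (I → ℤˣ) → ℝ) :
    traceVector (walshElement h f) = ∑ v, (walshCoeff f v : ℂ) • basisVector (h v) := by
  rw [walshElement, map_sum]
  refine Finset.sum_congr rfl fun v _ => ?_
  rw [map_smul, traceVector_canonicalUnitary]

theorem groupTrace_walshElement (hinj : Function.Injective h) (f : (I → ℤˣ) → ℝ) :
    groupTrace G (walshElement h f) = walshCoeff f 1 := by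
  rw [groupTrace_eq, ← inner_basisVector_left, traceVector_walshElement, ← map_one h]
  exact (orthonormal_basisVector.comp h hinj).inner_right_fintype
    (fun v => (walshCoeff f v : ℂ)) 1

/-- Parseval's identity, read off from multiplicativity and the fact that the trace is the mean. -/
theorem norm_traceVector_walshElement_sq (hinj : Function.Injective h) (f : (I → ℤˣ) → ℝ) :
    ‖traceVector (walshElement h f)‖ ^ 2 =
      ((2 : ℝ) ^ Fintype.card I)⁻¹ * ∑ ε, f ε ^ 2 := by
  have h1 := groupTrace_star_mul_self (walshElement h f)
  rw [star_walshElement, walshElement_mul, groupTrace_walshElement hinj,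
    walshCoeff_apply_one] at h1
  rw [← Complex.ofReal_inj.1 h1]
  simp only [Pi.mul_apply, sq]

/-- The identity is exact: the Walsh coefficients of a majority over `J` live on `v` trivial off
`J`, which is precisely where conjugation by `g` is known. -/
theorem canonicalUnitary_mul_walshElement_partialMajority {g : G} {J : Finset I}
    {π : Equiv.Perm I}
    (hg : ∀ v : I → ℤˣ, (∀ i ∉ J, v i = 1) → g * h v * g⁻¹ = h (v ∘ π.symm)) :
    canonicalUnitary g * walshElement h (partialMajority J) =
      walshElement h (partialMajority (J.map π.toEmbedding)) * canonicalUnitary g := by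
  rw [walshElement, walshElement, Finset.mul_sum, Finset.sum_mul]
  refine Fintype.sum_equiv (Equiv.arrowCongr π (Equiv.refl ℤˣ)) _ _ fun v => ?_
  change _ = (walshCoeff _ (v ∘ π.symm) : ℂ) • canonicalUnitary (h (v ∘ π.symm)) * _
  have hcoeff : walshCoeff (partialMajority (J.map π.toEmbedding)) (v ∘ π.symm) =
      walshCoeff (partialMajority J) v := by
    rw [← funext (partialMajority_comp_perm J π), ← walshCoeff_comp_perm, Function.comp_assoc,
      Equiv.symm_comp_self, Function.comp_id]
  rw [hcoeff]
  by_cases hv : ∀ i ∉ J, v i = 1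
  · rw [← hg v hv, smul_mul_assoc, mul_smul_comm, ← map_mul, ← map_mul, inv_mul_cancel_right]
  · push Not at hv
    obtain ⟨i, hi, hvi⟩ := hv
    rw [walshCoeff_eq_zero (partialMajority_mul_mulSingle hi) hvi, Complex.ofReal_zero, zero_smul,
      zero_smul, mul_zero, zero_mul]

theorem norm_traceVector_commutator_majority_lt (hinj : Function.Injective h) (i₀ : I) {g : G}
    {J : Finset I} {π : Equiv.Perm I}
    (hg : ∀ v : I → ℤˣ, (∀ i ∉ J, v i = 1) → g * h v * g⁻¹ = h (v ∘ π.symm))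
    {η ε : ℝ} (hη : 0 < η) (hε : 0 < ε) (hηε : 64 * η < ε ^ 2)
    (hn : 1 ≤ η ^ 2 * Fintype.card I) (hJ : (1 - η ^ 3) * Fintype.card I ≤ J.card) :
    ‖traceVector (canonicalUnitary g * walshElement h (majority i₀) -
      walshElement h (majority i₀) * canonicalUnitary g)‖ < ε := by
  have key : ∀ K : Finset I, K.card = J.card →
      ‖traceVector (walshElement h (majority i₀ - partialMajority K))‖ < ε / 2 := by
    intro K hK
    refine lt_of_pow_lt_pow_left₀ 2 (by positivity) ?_
    rw [norm_traceVector_walshElement_sq hinj]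
    refine (sum_sq_majority_sub_le i₀ K hη hn (by rwa [hK])).trans_lt ?_
    rw [div_pow]
    linarith
  -- Subtracting the exact intertwining relation leaves two error terms, each of norm below `ε / 2`
  -- because `16 * η < (ε / 2) ^ 2`.
  have hsplit : canonicalUnitary g * walshElement h (majority i₀) -
      walshElement h (majority i₀) * canonicalUnitary g =
      canonicalUnitary g * walshElement h (majority i₀ - partialMajority J) -
        walshElement h (majority i₀ - partialMajority (J.map π.toEmbedding)) *
          canonicalUnitary g := by
    rw [walshElement_sub, walshElement_sub, mul_sub, sub_mul,
      canonicalUnitary_mul_walshElement_partialMajority hg]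
    abel
  rw [hsplit, map_sub]
  refine (norm_sub_le _ _).trans_lt ?_
  rw [traceVector_canonicalUnitary_mul, traceVector_mul_canonicalUnitary,
    LinearIsometry.norm_map, LinearIsometry.norm_map]
  linarith [key J rfl, key (J.map π.toEmbedding) (Finset.card_map _)]

end WalshElement

/-! ### A criterion for property Gamma -/

section Criterion

/-- There are arbitrarily large finite families of independent commuting involutions in `G`, most of
whose members are permuted among themselves under conjugation by given elements. -/
def HasPermutedInvolutions (G : Type*) [Group G] (α : Type*) : Prop :=
  ∀ (S : Finset G) (δ : ℝ), 0 < δ → ∀ N : ℕ,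
    ∃ (I : Finset α) (h : (I → ℤˣ) →* G), N ≤ I.card ∧ Function.Injective h ∧
      ∀ g ∈ S, ∃ (J : Finset I) (π : Equiv.Perm I), (1 - δ) * I.card ≤ J.card ∧
        ∀ v : I → ℤˣ, (∀ i ∉ J, v i = 1) → g * h v * g⁻¹ = h (v ∘ π.symm)

variable {G α : Type*} [Group G]

theorem HasPermutedInvolutions.infinite (hG : HasPermutedInvolutions G α) (hICC : IsICC G) :
    Infinite G := by
  classical
  obtain ⟨I, h, hN, hinj, -⟩ := hG ∅ 1 one_pos 1
  obtain ⟨i, hi⟩ := Finset.card_pos.1 hN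
  have hne : h (Pi.mulSingle ⟨i, hi⟩ (-1)) ≠ 1 := by
    rw [← map_one h]
    refine fun h1 => (by decide : (-1 : ℤˣ) ≠ 1) ?_
    simpa using congrFun (hinj h1) ⟨i, hi⟩
  exact Set.infinite_univ_iff.1 ((hICC _ hne).mono (Set.subset_univ _))

theorem HasPermutedInvolutions.exists_unitary (hG : HasPermutedInvolutions G α) (S : Finset G)
    {ε : ℝ} (hε : 0 < ε) : ∃ u ∈ unitary (GroupVN G), groupTrace G u = 0 ∧
      ∀ g ∈ S, ‖traceVector (canonicalUnitary g * u - u * canonicalUnitary g)‖ < ε := by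
  classical
  obtain ⟨η, hη, hηε⟩ : ∃ η : ℝ, 0 < η ∧ 64 * η < ε ^ 2 :=
    ⟨ε ^ 2 / 128, by positivity, by linarith [sq_pos_of_pos hε]⟩
  obtain ⟨N, hN⟩ := exists_nat_ge (1 / η ^ 2)
  -- The proportion `η ^ 3` is what the Chebyshev estimate requires; `N + 1` makes `I` nonempty, so
  -- that a tie-breaking index exists.
  obtain ⟨I, h, hIN, hinj, hS⟩ := hG S (η ^ 3) (pow_pos hη 3) (N + 1)
  obtain ⟨i, hi⟩ := Finset.card_pos.1 ((Nat.succ_pos N).trans_le hIN)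
  have hn : 1 ≤ η ^ 2 * (Fintype.card I : ℝ) := by
    rw [Fintype.card_coe, ← div_le_iff₀' (by positivity)]
    refine hN.trans ?_
    exact_mod_cast (Nat.le_succ N).trans hIN
  refine ⟨walshElement h (majority ⟨i, hi⟩), walshElement_mem_unitary h (majority_sq _), ?_,
    fun g hg => ?_⟩
  · rw [groupTrace_walshElement hinj, walshCoeff_apply_one, sum_majority, mul_zero,
      Complex.ofReal_zero]
  · obtain ⟨J, π, hJ, hπ⟩ := hS g hg
    exact norm_traceVector_commutator_majority_lt hinj _ hπ hη hε hηε hn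
      (by rwa [Fintype.card_coe])

theorem HasPermutedInvolutions.hasPropertyGamma (hG : HasPermutedInvolutions G α)
    (hICC : IsICC G) : HasPropertyGamma G :=
  have := hG.infinite hICC
  hICC.hasPropertyGamma fun S _ hε => hG.exists_unitary S hε

end Criterion

/-! ### Property Gamma for groups between the alternating and the full group -/

theorem hasPermutedInvolutions_of_dynamicalAlternatingGroup_le {Γ X : Type*} [Group Γ]
    [Infinite Γ] (hΓ : IsAmenableGroup Γ) [TopologicalSpace X] [MulAction Γ X]
    [ContinuousConstSMul Γ X] [T2Space X] [CompactSpace X] [TotallyDisconnectedSpace X]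
    [Nonempty X] (hfree : IsTopologicallyFree Γ X) (G : Subgroup (topologicalFullGroup Γ X))
    (hG : dynamicalAlternatingGroup Γ X ≤ G) : HasPermutedInvolutions G Γ := by
  intro S δ hδ N
  obtain ⟨I, h, hN, hinj, hmem, hS⟩ :=
    exists_signHom hΓ hfree (S.map (Function.Embedding.subtype _)) hδ N
  refine ⟨I, h.codRestrict G fun v => hG (hmem v), hN,
    fun v w hvw => hinj (congrArg Subtype.val hvw), fun g hg => ?_⟩
  obtain ⟨J, π, hJ, hπ⟩ := hS g (Finset.mem_map.2 ⟨g, hg, rfl⟩)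
  exact ⟨J, π, hJ, fun v hv => Subtype.ext (hπ v hv)⟩

theorem mainTheorem1 {Γ X : Type*} [Group Γ] [Countable Γ] [Infinite Γ]
    (hΓ : IsAmenableGroup Γ)
    [TopologicalSpace X] (hX : Nonempty (X ≃ₜ cantorSet))
    [MulAction Γ X] [ContinuousConstSMul Γ X]
    (hfree : IsTopologicallyFree Γ X)
    (G : Subgroup (topologicalFullGroup Γ X))
    (hG : dynamicalAlternatingGroup Γ X ≤ G) :
    HasPropertyGamma G := by
  obtain ⟨e⟩ := hX
  let e' : (ℕ → Bool) ≃ₜ X := (e.trans cantorSetHomeomorphNatToBool).symm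
  have : CompactSpace X := e'.compactSpace
  have : T2Space X := e'.t2Space
  have : TotallyDisconnectedSpace X := e'.totallyDisconnectedSpace
  have : Nonempty X := ⟨e' fun _ => true⟩
  exact (hasPermutedInvolutions_of_dynamicalAlternatingGroup_le hΓ hfree G hG).hasPropertyGamma
    (isICC_of_dynamicalAlternatingGroup_le hfree G hG)
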